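/- Let $\varepsilon,\gamma\in\mathbb R\setminus\{0\}$ and consider the 2D viscoelastic equation $$u_{tt}-\varepsilon\,\partial_t\Delta u-\gamma\,\Delta u=f,\qquad \Delta=\partial_x^2+\partial_y^2,$$ as one equation for two dependent variables $u,f$ of the independent variables $x,y,t$. Let $M\subseteq\mathbb R^3\times\mathbb R^2$ be an open connected subset of the space with coordinates $(x,y,t;u,f)$ whose fibres over points $(x,y,t)$ are connected (for instance $M=\mathbb R^5$), and let $\Omega\subseteq\mathbb R^3$ be its projection to $(x,y,t)$-space. A smooth vector field $$V=\xi^1\partial_x+\xi^2\partial_y+\xi^3\partial_t+\phi_1\partial_u+\phi_2\partial_f$$ on $M$, with coefficients depending on $(x,y,t,u,f)$, is called an infinitesimal point symmetry of the equation if its third prolongation satisfies $$\mathrm{Pr}^{(3)}V\,[\,u_{tt}-\varepsilon\,\partial_t\Delta u-\gamma\,\Delta u-f\,]=0\quad\text{whenever}\quad u_{tt}-\varepsilon\,\partial_t\Delta u-\gamma\,\Delta u-f=0$$ (at all 3-jets over $M$). Then $V$ is an infinitesimal point symmetry if and only if there are constants $c_1,\dots,c_5\in\mathbb R$ and a smooth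 function $F_2:\Omega\to\mathbb R$ such that on $M$ $$\xi^1=c_1y+c_2,\qquad \xi^2=-c_1x+c_3,\qquad \xi^3=c_4,$$ $$\phi_1=c_5u+F_2(x,y,t),\qquad \phi_2=c_5f+\partial_t^2F_2-\varepsilon\,\partial_t\Delta F_2-\gamma\,\Delta F_2 .$$ Moreover, the infinitesimal point symmetries on $M$ form a real Lie algebra: they are closed under linear combinations and under the Lie bracket of vector fields. -/

import Mathlib

open scoped ContDiff

noncomputable section

namespace Viscoelastic

/-- Space of independent variables `(x, y, t)`, with indices `0, 1, 2`. -/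
abbrev Base : Type := Fin 3 → ℝ

/-- Space of dependent variables `(u, f)`, with indices `0, 1`. -/
abbrev Fibre : Type := Fin 2 → ℝ

/-- Total space with coordinates `((x, y, t), (u, f))`. -/
abbrev Total : Type := Base × Fibre

/-- Multi-indices of partial derivatives in `(x, y, t)`. -/
abbrev MultiIndex : Type := Fin 3 → ℕ

/-- Jet space: `z.1` is the base point and `z.2 α J` is the jet coordinate `u^α_J`,
where `u^0 = u` and `u^1 = f`. Jets of all orders are collected in one space. -/
abbrev Jet : Type := Base × (Fin 2 → MultiIndex → ℝ)

/-- The projection of a jet to the total space. -/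
def proj (z : Jet) : Total := (z.1, fun α => z.2 α 0)

/-- The multi-index `e_k`. -/
def unitIndex (k : Fin 3) : MultiIndex := Pi.single k 1

/-- The vector `∂_{x^k} + ∑_{α, J} u^α_{J + e_k} ∂_{u^α_J}` at the jet `z`. -/
def shift (k : Fin 3) (z : Jet) : Jet :=
  (Pi.single k 1, fun α J => z.2 α (J + unitIndex k))

/-- The total derivative `D_k P = ∂P/∂x^k + ∑_{α, J} u^α_{J + e_k} ∂P/∂u^α_J`, which for a
differentiable function of finitely many jet coordinates is the derivative of `P` at `z`
in the direction `shift k z`. -/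
def totalDeriv (k : Fin 3) (P : Jet → ℝ) : Jet → ℝ :=
  fun z => lineDeriv ℝ P z (shift k z)

/-- The iterated total derivative `D^J`. -/
def totalDerivIter (J : MultiIndex) (P : Jet → ℝ) : Jet → ℝ :=
  (totalDeriv 0)^[J 0] ((totalDeriv 1)^[J 1] ((totalDeriv 2)^[J 2] P))

/-- The characteristic `Q_α = φ_α - ∑ i, ξ^i u^α_i` of the vector field
`V = ∑ i, ξ^i ∂_{x^i} + ∑ α, φ_α ∂_{u^α}`, where `V p = (ξ p, φ p)`. -/
def characteristic (V : Total → Total) (α : Fin 2) (z : Jet) : ℝ :=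
  (V (proj z)).2 α - ∑ i : Fin 3, (V (proj z)).1 i * z.2 α (unitIndex i)

/-- The coefficient `φ_α^J = D^J Q_α + ∑ i, ξ^i u^α_{J + e_i}` of the prolongation. -/
def prolongCoeff (V : Total → Total) (α : Fin 2) (J : MultiIndex) (z : Jet) : ℝ :=
  totalDerivIter J (characteristic V α) z
    + ∑ i : Fin 3, (V (proj z)).1 i * z.2 α (J + unitIndex i)

/-- The prolongation `∑ i, ξ^i ∂_{x^i} + ∑_{α, J} φ_α^J ∂_{u^α_J}` of `V`. -/
def prolong (V : Total → Total) (z : Jet) : Jet :=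
  ((V (proj z)).1, fun α J => prolongCoeff V α J z)

/-- The prolongation of `V` applied, as a derivation, to a function `P` of the jet. If `P`
depends on derivatives of order at most `n` only, this is `Pr^(n) V [P]`. -/
def prolongApply (V : Total → Total) (P : Jet → ℝ) (z : Jet) : ℝ :=
  lineDeriv ℝ P z (prolong V z)

/-- The differential function `u_tt - ε ∂_t (u_xx + u_yy) - γ (u_xx + u_yy) - f`. -/
def equation (ε γ : ℝ) (z : Jet) : ℝ :=
  z.2 0 ![0, 0, 2] - ε * (z.2 0 ![2, 0, 1] + z.2 0 ![0, 2, 1])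
    - γ * (z.2 0 ![2, 0, 0] + z.2 0 ![0, 2, 0]) - z.2 1 0

/-- `V` is a (smooth) infinitesimal point symmetry, on the open set `M` of the total space, of
`u_tt - ε ∂_t Δu - γ Δu = f` with `u` and `f` both dependent variables: the prolongation of `V`
annihilates the equation at every jet over `M` that satisfies the equation. -/
structure IsInfinitesimalSymmetry (ε γ : ℝ) (M : Set Total) (V : Total → Total) : Prop where
  smooth : ContDiffOn ℝ ∞ V M
  invariance : ∀ z : Jet, proj z ∈ M → equation ε γ z = 0 →
    prolongApply V (equation ε γ) z = 0

/-- Partial derivative of a function of `(x, y, t)`. -/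
def pderiv (i : Fin 3) (G : Base → ℝ) : Base → ℝ :=
  fun q => fderiv ℝ G q (Pi.single i 1)

/-- The Laplacian in the space variables `(x, y)`. -/
def laplacian (G : Base → ℝ) : Base → ℝ :=
  fun q => pderiv 0 (pderiv 0 G) q + pderiv 1 (pderiv 1 G) q

/-- The linear operator `G ↦ G_tt - ε ∂_t ΔG - γ ΔG`. -/
def viscoOp (ε γ : ℝ) (G : Base → ℝ) : Base → ℝ :=
  fun q => pderiv 2 (pderiv 2 G) q - ε * pderiv 2 (laplacian G) q - γ * laplacian G q

/-- The vector field with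
`ξ¹ = c₁ y + c₂`, `ξ² = -c₁ x + c₃`, `ξ³ = c₄`, `φ₁ = c₅ u + F`, `φ₂ = c₅ f + L F`. -/
def generator (ε γ c₁ c₂ c₃ c₄ c₅ : ℝ) (F : Base → ℝ) : Total → Total :=
  fun p =>
    (![c₁ * p.1 1 + c₂, -c₁ * p.1 0 + c₃, c₄],
     ![c₅ * p.2 0 + F p.1, c₅ * p.2 1 + viscoOp ε γ F p.1])

end Viscoelastic

end

/-! The equation is linear in the jet coordinates, so the prolongation applied to it is the equation
evaluated at the prolongation coefficients (`prolongApply_equation`). Expanding the total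
derivatives of the characteristic (`equation_prolong`) turns invariance over a point `p` into a
polynomial identity in the jet coordinates over `p`. On solutions `u_tt` is determined by the
others, and every other coordinate is free.

Coefficients are extracted with sparse jets: all coordinates of positive order vanish except a few
parameters and the value of `u_tt` forced by the equation, and two parameter values are compared.
The term `f_xxt` shows that `ξ` and `φ₁` do not depend on `f`. The third-order terms in `u` make
`ξ¹, ξ²` functions of `(x, y)` and `ξ³` a function of `t`, with `ξ²_x = -ξ¹_y` and `ξ¹_x = ξ²_y =
ξ³_t / 2`. As `ξ¹` does not see `t` and `ξ³` sees only `t`, the second derivatives of `ξ` vanish; a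
rotation, translations and one scaling survive. The lower-order terms make `∂φ₁/∂u` constant, and
the `u_xx` term then gives `γ ξ³_t = 0`, which kills the scaling since `γ ≠ 0`. The remaining term,
free of parameters, is a formula for `φ₂`.

Connectedness of `M` integrates these identities to constants; connectedness of the fibres makes `φ₁
- c₅ u` a function on the base. Conversely, the prolongation of a generator maps the equation to
`c₅` times itself. Lie closure follows from the normal form, because rotations and translations
commute with the operator `viscoOp` (`viscoOp_killingDeriv`). -/

noncomputable section

namespace Viscoelastic

/-! ### Total derivatives as derivatives along lines in jet space -/

/-- The coefficient `ξ^i` of a vector field. -/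
abbrev xi (V : Total → Total) (i : Fin 3) (p : Total) : ℝ := (V p).1 i

/-- The coefficient `φ_α` of a vector field. -/
abbrev phi (V : Total → Total) (α : Fin 2) (p : Total) : ℝ := (V p).2 α

/-- The coordinate vector field `∂/∂x^k` on the total space. -/
def baseVec (k : Fin 3) : Total := (Pi.single k 1, 0)

/-- The coordinate vector field `∂/∂u^α` on the total space. -/
def fibreVec (α : Fin 2) : Total := (0, Pi.single α 1)

/-- The vertical vector `∑ α, u^α_J ∂/∂u^α`. -/
def vertVec (J : MultiIndex) (z : Jet) : Total := (0, fun α => z.2 α J)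

/-- The total derivative vector `∂/∂x^k + ∑ α, u^α_k ∂/∂u^α`. -/
def totalVec (k : Fin 3) (z : Jet) : Total :=
  (Pi.single k 1, fun α => z.2 α (unitIndex k))

theorem vertVec_eq (J : MultiIndex) (z : Jet) :
    vertVec J z = z.2 0 J • fibreVec 0 + z.2 1 J • fibreVec 1 := by
  ext i
  · simp [vertVec, fibreVec]
  · fin_cases i <;> simp [vertVec, fibreVec]

theorem totalVec_eq (k : Fin 3) (z : Jet) :
    totalVec k z = baseVec k + z.2 0 (unitIndex k) • fibreVec 0
      + z.2 1 (unitIndex k) • fibreVec 1 := by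
  ext i
  · simp [totalVec, baseVec, fibreVec]
  · fin_cases i <;> simp [totalVec, baseVec, fibreVec]

/-- The frozen direction `shift k z` projects to a straight line in the total space, so total
derivatives of functions pulled back from there are ordinary directional derivatives. -/
theorem proj_line (k : Fin 3) (z : Jet) (t : ℝ) :
    proj (z + t • shift k z) = proj z + t • totalVec k z := by
  ext i <;> simp [proj, shift, totalVec]

theorem totalVec_line (l k : Fin 3) (z : Jet) (t : ℝ) :
    totalVec l (z + t • shift k z)
      = totalVec l z + t • vertVec (unitIndex l + unitIndex k) z := by
  ext i <;> simp [vertVec, shift, totalVec]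

theorem vertVec_line (J : MultiIndex) (k : Fin 3) (z : Jet) (t : ℝ) :
    vertVec J (z + t • shift k z) = vertVec J z + t • vertVec (J + unitIndex k) z := by
  ext i <;> simp [vertVec, shift]

/-- At every jet over `M` the function `P` has the total derivative `P'` in the direction `k`. -/
def HasTotalDeriv (M : Set Total) (k : Fin 3) (P P' : Jet → ℝ) : Prop :=
  ∀ z, proj z ∈ M → HasDerivAt (fun t : ℝ => P (z + t • shift k z)) (P' z) 0

section TotalDeriv

variable {M : Set Total} {k : Fin 3} {P P' R R' : Jet → ℝ}

theorem HasTotalDeriv.eqOn (h : HasTotalDeriv M k P P') :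
    Set.EqOn (totalDeriv k P) P' (proj ⁻¹' M) :=
  fun z hz => (h z hz).deriv

/-- As `M` is open, a short piece of the line stays over `M`, so only values over `M` matter. This
permits iterating `totalDeriv`, whose closed form is known only there. -/
theorem HasTotalDeriv.congr (hM : IsOpen M) (h : HasTotalDeriv M k P P')
    (hR : Set.EqOn R P (proj ⁻¹' M)) : HasTotalDeriv M k R P' := by
  intro z hz
  refine (h z hz).congr_of_eventuallyEq ?_
  have hc : Continuous fun t : ℝ => proj z + t • totalVec k z := by fun_prop
  have : ∀ᶠ t : ℝ in nhds 0, proj z + t • totalVec k z ∈ M :=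
    hc.continuousAt.eventually_mem (hM.mem_nhds (by simpa using hz))
  filter_upwards [this] with t ht
  exact hR (by simpa [proj_line] using ht)

theorem HasTotalDeriv.add (h : HasTotalDeriv M k P P') (hR : HasTotalDeriv M k R R') :
    HasTotalDeriv M k (fun z => P z + R z) (fun z => P' z + R' z) :=
  fun z hz => (h z hz).add (hR z hz)

theorem HasTotalDeriv.sub (h : HasTotalDeriv M k P P') (hR : HasTotalDeriv M k R R') :
    HasTotalDeriv M k (fun z => P z - R z) (fun z => P' z - R' z) :=
  fun z hz => (h z hz).sub (hR z hz)

theorem HasTotalDeriv.mul (h : HasTotalDeriv M k P P') (hR : HasTotalDeriv M k R R') :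
    HasTotalDeriv M k (fun z => P z * R z) (fun z => P' z * R z + P z * R' z) := by
  intro z hz
  exact ((h z hz).fun_mul (hR z hz)).congr_deriv (by simp)

theorem HasTotalDeriv.sum {P P' : Fin 3 → Jet → ℝ} (h : ∀ i, HasTotalDeriv M k (P i) (P' i)) :
    HasTotalDeriv M k (fun z => ∑ i, P i z) (fun z => ∑ i, P' i z) := by
  intro z hz
  exact HasDerivAt.fun_sum fun i _ => h i z hz

theorem hasTotalDeriv_coord (α : Fin 2) (J : MultiIndex) :
    HasTotalDeriv M k (fun z => z.2 α J) (fun z => z.2 α (J + unitIndex k)) := by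
  intro z _
  simpa [shift] using ((hasDerivAt_id (0 : ℝ)).mul_const (z.2 α (J + unitIndex k))).const_add
    (z.2 α J)

theorem hasDerivAt_line {E : Type*} [NormedAddCommGroup E] [NormedSpace ℝ E] (a b : E) :
    HasDerivAt (fun t : ℝ => a + t • b) b 0 := by
  simpa using ((hasDerivAt_id (0 : ℝ)).smul_const b).const_add a

theorem hasDerivAt_comp_line {E : Type*} [NormedAddCommGroup E] [NormedSpace ℝ E]
    {g : Total → E} {p v : Total} (hg : DifferentiableAt ℝ g p) :
    HasDerivAt (fun t : ℝ => g (p + t • v)) (fderiv ℝ g p v) 0 := by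
  have h : HasFDerivAt g (fderiv ℝ g p) (p + (0 : ℝ) • v) := by simpa using hg.hasFDerivAt
  exact h.comp_hasDerivAt (0 : ℝ) (hasDerivAt_line p v)

end TotalDeriv

/-! ### Closed forms for the total derivatives of smooth functions -/

/-- The first total derivative of a function on the total space. -/
def jetD (h : Total → ℝ) (k : Fin 3) (z : Jet) : ℝ := fderiv ℝ h (proj z) (totalVec k z)

/-- The second total derivative of a function on the total space. -/
def jetD2 (h : Total → ℝ) (k l : Fin 3) (z : Jet) : ℝ :=
  fderiv ℝ (fderiv ℝ h) (proj z) (totalVec l z) (totalVec k z)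
    + fderiv ℝ h (proj z) (vertVec (unitIndex k + unitIndex l) z)

/-- The third total derivative of a function on the total space. -/
def jetD3 (h : Total → ℝ) (k l m : Fin 3) (z : Jet) : ℝ :=
  fderiv ℝ (fderiv ℝ (fderiv ℝ h)) (proj z) (totalVec m z) (totalVec l z) (totalVec k z)
    + fderiv ℝ (fderiv ℝ h) (proj z) (vertVec (unitIndex l + unitIndex m) z) (totalVec k z)
    + fderiv ℝ (fderiv ℝ h) (proj z) (totalVec l z) (vertVec (unitIndex k + unitIndex m) z)
    + fderiv ℝ (fderiv ℝ h) (proj z) (totalVec m z) (vertVec (unitIndex k + unitIndex l) z)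
    + fderiv ℝ h (proj z) (vertVec (unitIndex k + unitIndex l + unitIndex m) z)

section Smooth

variable {M : Set Total} {h : Total → ℝ}

theorem contDiffOn_fderiv {E F : Type*} [NormedAddCommGroup E] [NormedSpace ℝ E]
    [NormedAddCommGroup F] [NormedSpace ℝ F] {s : Set E} {g : E → F}
    (hs : IsOpen s) (hg : ContDiffOn ℝ ∞ g s) : ContDiffOn ℝ ∞ (fderiv ℝ g) s :=
  hg.fderiv_of_isOpen hs (by simp)

theorem differentiableAt_of_contDiffOn {E F : Type*} [NormedAddCommGroup E] [NormedSpace ℝ E]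
    [NormedAddCommGroup F] [NormedSpace ℝ F] {s : Set E} {g : E → F} {x : E}
    (hs : IsOpen s) (hg : ContDiffOn ℝ ∞ g s) (hx : x ∈ s) : DifferentiableAt ℝ g x :=
  (hg.contDiffAt (hs.mem_nhds hx)).differentiableAt (by simp)

theorem hasTotalDeriv_comp_proj (hM : IsOpen M) (hh : ContDiffOn ℝ ∞ h M) (k : Fin 3) :
    HasTotalDeriv M k (fun z => h (proj z)) (jetD h k) := by
  intro z hz
  simp only [proj_line]
  exact hasDerivAt_comp_line (differentiableAt_of_contDiffOn hM hh hz)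

theorem hasTotalDeriv_jetD (hM : IsOpen M) (hh : ContDiffOn ℝ ∞ h M) (k l : Fin 3) :
    HasTotalDeriv M l (jetD h k) (jetD2 h k l) := by
  intro z hz
  have h1 := hasDerivAt_comp_line (v := totalVec l z)
    (differentiableAt_of_contDiffOn hM (contDiffOn_fderiv hM hh) hz)
  have := h1.clm_apply (hasDerivAt_line (totalVec k z) (vertVec (unitIndex k + unitIndex l) z))
  simp only [jetD, proj_line, totalVec_line]
  exact this.congr_deriv (by simp only [jetD2, zero_smul, add_zero])

theorem hasTotalDeriv_jetD2 (hM : IsOpen M) (hh : ContDiffOn ℝ ∞ h M) (k l m : Fin 3) :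
    HasTotalDeriv M m (jetD2 h k l) (jetD3 h k l m) := by
  intro z hz
  have hh1 := contDiffOn_fderiv hM hh
  have h1 := hasDerivAt_comp_line (v := totalVec m z) (differentiableAt_of_contDiffOn hM hh1 hz)
  have h2 := hasDerivAt_comp_line (v := totalVec m z)
    (differentiableAt_of_contDiffOn hM (contDiffOn_fderiv hM hh1) hz)
  have h3 := ((h2.clm_apply (hasDerivAt_line (totalVec l z)
      (vertVec (unitIndex l + unitIndex m) z))).clm_apply
    (hasDerivAt_line (totalVec k z) (vertVec (unitIndex k + unitIndex m) z))).add
    (h1.clm_apply (hasDerivAt_line (vertVec (unitIndex k + unitIndex l) z)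
      (vertVec (unitIndex k + unitIndex l + unitIndex m) z)))
  simp only [jetD2, proj_line, totalVec_line, vertVec_line]
  refine h3.congr_deriv ?_
  simp only [jetD3, zero_smul, add_zero, add_apply]
  ring

end Smooth

/-! ### Total derivatives of the characteristic up to order three -/

section Characteristic

variable {M : Set Total} {V : Total → Total}

/-- The first total derivative of the characteristic. -/
def charD (V : Total → Total) (α : Fin 2) (k : Fin 3) (z : Jet) : ℝ :=
  jetD (phi V α) k z
    - ∑ i, (jetD (xi V i) k z * z.2 α (unitIndex i)
      + (V (proj z)).1 i * z.2 α (unitIndex i + unitIndex k))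

/-- The second total derivative of the characteristic. -/
def charD2 (V : Total → Total) (α : Fin 2) (k l : Fin 3) (z : Jet) : ℝ :=
  jetD2 (phi V α) k l z
    - ∑ i, (jetD2 (xi V i) k l z * z.2 α (unitIndex i)
        + jetD (xi V i) k z * z.2 α (unitIndex i + unitIndex l)
      + (jetD (xi V i) l z * z.2 α (unitIndex i + unitIndex k)
        + (V (proj z)).1 i * z.2 α (unitIndex i + unitIndex k + unitIndex l)))

/-- The third total derivative of the characteristic. -/
def charD3 (V : Total → Total) (α : Fin 2) (k l m : Fin 3) (z : Jet) : ℝ :=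
  jetD3 (phi V α) k l m z
    - ∑ i, (jetD3 (xi V i) k l m z * z.2 α (unitIndex i)
          + jetD2 (xi V i) k l z * z.2 α (unitIndex i + unitIndex m)
        + (jetD2 (xi V i) k m z * z.2 α (unitIndex i + unitIndex l)
          + jetD (xi V i) k z * z.2 α (unitIndex i + unitIndex l + unitIndex m))
      + (jetD2 (xi V i) l m z * z.2 α (unitIndex i + unitIndex k)
          + jetD (xi V i) l z * z.2 α (unitIndex i + unitIndex k + unitIndex m)
        + (jetD (xi V i) m z * z.2 α (unitIndex i + unitIndex k + unitIndex l)
          + (V (proj z)).1 i * z.2 α (unitIndex i + unitIndex k + unitIndex l + unitIndex m))))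

theorem contDiffOn_fst_comp (hV : ContDiffOn ℝ ∞ V M) (i : Fin 3) :
    ContDiffOn ℝ ∞ (xi V i) M :=
  contDiffOn_pi.1 hV.fst i

theorem contDiffOn_snd_comp (hV : ContDiffOn ℝ ∞ V M) (α : Fin 2) :
    ContDiffOn ℝ ∞ (phi V α) M :=
  contDiffOn_pi.1 hV.snd α

/-- The sums in `charD`, `charD2` and `charD3` are grouped exactly as the product rule produces
them, so the rules for `HasTotalDeriv` compose to a proof without rearrangement. -/
theorem hasTotalDeriv_characteristic (hM : IsOpen M) (hV : ContDiffOn ℝ ∞ V M) (α : Fin 2)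
    (k : Fin 3) : HasTotalDeriv M k (characteristic V α) (charD V α k) :=
  (hasTotalDeriv_comp_proj hM (contDiffOn_snd_comp hV α) k).sub <| HasTotalDeriv.sum fun i =>
    (hasTotalDeriv_comp_proj hM (contDiffOn_fst_comp hV i) k).mul (hasTotalDeriv_coord _ _)

theorem hasTotalDeriv_charD (hM : IsOpen M) (hV : ContDiffOn ℝ ∞ V M) (α : Fin 2)
    (k l : Fin 3) : HasTotalDeriv M l (charD V α k) (charD2 V α k l) :=
  (hasTotalDeriv_jetD hM (contDiffOn_snd_comp hV α) k l).sub <| HasTotalDeriv.sum fun i =>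
    ((hasTotalDeriv_jetD hM (contDiffOn_fst_comp hV i) k l).mul (hasTotalDeriv_coord _ _)).add
    ((hasTotalDeriv_comp_proj hM (contDiffOn_fst_comp hV i) l).mul (hasTotalDeriv_coord _ _))

theorem hasTotalDeriv_charD2 (hM : IsOpen M) (hV : ContDiffOn ℝ ∞ V M) (α : Fin 2)
    (k l m : Fin 3) : HasTotalDeriv M m (charD2 V α k l) (charD3 V α k l m) :=
  (hasTotalDeriv_jetD2 hM (contDiffOn_snd_comp hV α) k l m).sub <| HasTotalDeriv.sum fun i =>
    (((hasTotalDeriv_jetD2 hM (contDiffOn_fst_comp hV i) k l m).mul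
        (hasTotalDeriv_coord _ _)).add
      ((hasTotalDeriv_jetD hM (contDiffOn_fst_comp hV i) k m).mul
        (hasTotalDeriv_coord _ _))).add
    (((hasTotalDeriv_jetD hM (contDiffOn_fst_comp hV i) l m).mul (hasTotalDeriv_coord _ _)).add
      ((hasTotalDeriv_comp_proj hM (contDiffOn_fst_comp hV i) m).mul
        (hasTotalDeriv_coord _ _)))

theorem totalDeriv_totalDeriv_characteristic (hM : IsOpen M) (hV : ContDiffOn ℝ ∞ V M)
    (α : Fin 2) (k l : Fin 3) :
    Set.EqOn (totalDeriv l (totalDeriv k (characteristic V α))) (charD2 V α k l)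
      (proj ⁻¹' M) :=
  ((hasTotalDeriv_charD hM hV α k l).congr hM (hasTotalDeriv_characteristic hM hV α k).eqOn).eqOn

theorem totalDeriv_totalDeriv_totalDeriv_characteristic (hM : IsOpen M)
    (hV : ContDiffOn ℝ ∞ V M) (α : Fin 2) (k l m : Fin 3) :
    Set.EqOn (totalDeriv m (totalDeriv l (totalDeriv k (characteristic V α))))
      (charD3 V α k l m) (proj ⁻¹' M) :=
  ((hasTotalDeriv_charD2 hM hV α k l m).congr hM
    (totalDeriv_totalDeriv_characteristic hM hV α k l)).eqOn

end Characteristic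

/-! ### The prolonged equation and the test jets -/

/-- A linear function is its own derivative, and `equation` is linear in the jet. -/
theorem prolongApply_equation (ε γ : ℝ) (V : Total → Total) (z : Jet) :
    prolongApply V (equation ε γ) z = equation ε γ (prolong V z) := by
  have h : ∀ t : ℝ, equation ε γ (z + t • prolong V z)
      = equation ε γ z + t • equation ε γ (prolong V z) := by
    intro t
    simp only [equation, Prod.snd_add, Prod.smul_snd, Pi.add_apply, Pi.smul_apply, smul_eq_mul]
    ring
  simp only [prolongApply, lineDeriv, h]
  exact (hasDerivAt_line _ _).deriv

theorem unitIndex_zero : unitIndex 0 = ![1, 0, 0] := by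
  ext i; fin_cases i <;> simp [unitIndex]

theorem unitIndex_one : unitIndex 1 = ![0, 1, 0] := by
  ext i; fin_cases i <;> simp [unitIndex]

theorem unitIndex_two : unitIndex 2 = ![0, 0, 1] := by
  ext i; fin_cases i <;> simp [unitIndex]


/-- The prolongation of a vector field applied to the equation, in closed form. -/
theorem equation_prolong {M : Set Total} {V : Total → Total} (hM : IsOpen M)
    (hV : ContDiffOn ℝ ∞ V M) (ε γ : ℝ) {z : Jet} (hz : proj z ∈ M) :
    equation ε γ (prolong V z) =
      (charD2 V 0 2 2 z + ∑ i, (V (proj z)).1 i * z.2 0 (![0, 0, 2] + unitIndex i))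
      - ε * ((charD3 V 0 2 0 0 z + ∑ i, (V (proj z)).1 i * z.2 0 (![2, 0, 1] + unitIndex i))
        + (charD3 V 0 2 1 1 z + ∑ i, (V (proj z)).1 i * z.2 0 (![0, 2, 1] + unitIndex i)))
      - γ * ((charD2 V 0 0 0 z + ∑ i, (V (proj z)).1 i * z.2 0 (![2, 0, 0] + unitIndex i))
        + (charD2 V 0 1 1 z + ∑ i, (V (proj z)).1 i * z.2 0 (![0, 2, 0] + unitIndex i)))
      - (V (proj z)).2 1 := by
  have h0 : prolongCoeff V 1 0 z = (V (proj z)).2 1 := by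
    simp [prolongCoeff, totalDerivIter, characteristic]
  simp only [equation, prolong, h0]
  -- `totalDerivIter` applies the time derivative first, whence the index orders `2 0 0` and `2 1
  -- 1`.
  simp only [← totalDeriv_totalDeriv_characteristic hM hV 0 _ _ hz,
    ← totalDeriv_totalDeriv_totalDeriv_characteristic hM hV 0 _ _ _ hz]
  rfl

/-- The jet over `p` whose coordinates of positive order are `u_{ijk} = a i j k` and
`f_{ijk} = b i j k`. -/
def jetOver (p : Total) (a b : ℕ → ℕ → ℕ → ℝ) : Jet :=
  (p.1, fun α J => if J = 0 then p.2 α else ![a (J 0) (J 1) (J 2), b (J 0) (J 1) (J 2)] α)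

theorem proj_jetOver (p : Total) (a b : ℕ → ℕ → ℕ → ℝ) : proj (jetOver p a b) = p := by
  simp [proj, jetOver]

theorem jetOver_snd_zero (p : Total) (a b : ℕ → ℕ → ℕ → ℝ) (J : MultiIndex) :
    (jetOver p a b).2 0 J = if J = 0 then p.2 0 else a (J 0) (J 1) (J 2) := rfl

theorem jetOver_snd_one (p : Total) (a b : ℕ → ℕ → ℕ → ℝ) (J : MultiIndex) :
    (jetOver p a b).2 1 J = if J = 0 then p.2 1 else b (J 0) (J 1) (J 2) := rfl

theorem unitIndex_ne_zero (k : Fin 3) : unitIndex k ≠ 0 := by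
  simp [unitIndex]

theorem equation_jetOver (ε γ : ℝ) (p : Total) (a b : ℕ → ℕ → ℕ → ℝ) :
    equation ε γ (jetOver p a b) = a 0 0 2 - ε * (a 2 0 1 + a 0 2 1)
      - γ * (a 2 0 0 + a 0 2 0) - p.2 1 := by
  simp [equation, jetOver_snd_zero, jetOver_snd_one]

/-! ### Differentiating pointwise identities between directional derivatives -/

section Directional

variable {E : Type*} [NormedAddCommGroup E] [NormedSpace ℝ E] {s : Set E} {h g : E → ℝ}

theorem fderiv_fderiv_apply (hs : IsOpen s) (hh : ContDiffOn ℝ ∞ h s) {p : E} (hp : p ∈ s)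
    (v w : E) : fderiv ℝ (fderiv ℝ h) p v w = fderiv ℝ (fun q => fderiv ℝ h q w) p v := by
  have h1 := differentiableAt_of_contDiffOn hs (contDiffOn_fderiv hs hh) hp
  rw [fderiv_clm_apply h1 (differentiableAt_const w)]
  simp

theorem fderiv_fderiv_fderiv_apply (hs : IsOpen s) (hh : ContDiffOn ℝ ∞ h s) {p : E}
    (hp : p ∈ s) (v w w' : E) : fderiv ℝ (fderiv ℝ (fderiv ℝ h)) p v w w'
      = fderiv ℝ (fun q => fderiv ℝ (fderiv ℝ h) q w w') p v := by
  have h1 := differentiableAt_of_contDiffOn hs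
    (contDiffOn_fderiv hs (contDiffOn_fderiv hs hh)) hp
  have h2 := h1.clm_apply (differentiableAt_const w)
  rw [fderiv_clm_apply h2 (differentiableAt_const w'),
    fderiv_clm_apply h1 (differentiableAt_const w)]
  simp

theorem fderiv_fderiv_comm {F : Type*} [NormedAddCommGroup F] [NormedSpace ℝ F] {h : E → F}
    (hs : IsOpen s) (hh : ContDiffOn ℝ ∞ h s) {p : E} (hp : p ∈ s) (v w : E) :
    fderiv ℝ (fderiv ℝ h) p v w = fderiv ℝ (fderiv ℝ h) p w v :=
  ((hh.contDiffAt (hs.mem_nhds hp)).isSymmSndFDerivAt (by simp; exact WithTop.coe_le_coe.2 le_top)).eq v w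

theorem fderiv_congr_of_eqOn {F : Type*} [NormedAddCommGroup F] [NormedSpace ℝ F]
    {h g : E → F} (hs : IsOpen s) (hg : Set.EqOn h g s) {p : E} (hp : p ∈ s) :
    fderiv ℝ h p = fderiv ℝ g p :=
  (hg.eventuallyEq_of_mem (hs.mem_nhds hp)).fderiv_eq

theorem fderiv_fderiv_eq_zero (hs : IsOpen s) (hh : ContDiffOn ℝ ∞ h s) {w : E}
    (hw : ∀ p ∈ s, fderiv ℝ h p w = 0) {p : E} (hp : p ∈ s) (v : E) :
    fderiv ℝ (fderiv ℝ h) p v w = 0 := by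
  rw [fderiv_fderiv_apply hs hh hp, fderiv_congr_of_eqOn (g := fun _ => 0) hs hw hp]
  simp

theorem fderiv_fderiv_eq_zero_left (hs : IsOpen s) (hh : ContDiffOn ℝ ∞ h s) {w : E}
    (hw : ∀ p ∈ s, fderiv ℝ h p w = 0) {p : E} (hp : p ∈ s) (v : E) :
    fderiv ℝ (fderiv ℝ h) p w v = 0 := by
  rw [fderiv_fderiv_comm hs hh hp, fderiv_fderiv_eq_zero hs hh hw hp]

theorem fderiv_fderiv_eq_mul (hs : IsOpen s) (hh : ContDiffOn ℝ ∞ h s)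
    (hg : ContDiffOn ℝ ∞ g s) {w w' : E} {c : ℝ}
    (hw : ∀ p ∈ s, fderiv ℝ h p w = c * fderiv ℝ g p w') {p : E} (hp : p ∈ s) (v : E) :
    fderiv ℝ (fderiv ℝ h) p v w = c * fderiv ℝ (fderiv ℝ g) p v w' := by
  rw [fderiv_fderiv_apply hs hh hp, fderiv_fderiv_apply hs hg hp,
    fderiv_congr_of_eqOn hs hw hp, fderiv_const_mul]
  · simp
  · exact (differentiableAt_of_contDiffOn hs (contDiffOn_fderiv hs hg) hp).clm_apply
      (differentiableAt_const w')

theorem fderiv_fderiv_fderiv_eq_zero (hs : IsOpen s) (hh : ContDiffOn ℝ ∞ h s) {w w' : E}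
    (hw : ∀ p ∈ s, fderiv ℝ (fderiv ℝ h) p w w' = 0) {p : E} (hp : p ∈ s) (v : E) :
    fderiv ℝ (fderiv ℝ (fderiv ℝ h)) p v w w' = 0 := by
  rw [fderiv_fderiv_fderiv_apply hs hh hp, fderiv_congr_of_eqOn (g := fun _ => 0) hs hw hp]
  simp

end Directional

/-! ### The determining equations -/

section Determining

variable {ε γ : ℝ} {M : Set Total} {V : Total → Total}

/-- The symmetry condition at the jets over `p` with prescribed coordinates. -/
theorem IsInfinitesimalSymmetry.prolong_jetOver
    (hM : IsOpen M) (hV : IsInfinitesimalSymmetry ε γ M V) {p : Total} (hp : p ∈ M)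
    (a b : ℕ → ℕ → ℕ → ℝ)
    (ha : a 0 0 2 = p.2 1 + ε * (a 2 0 1 + a 0 2 1) + γ * (a 2 0 0 + a 0 2 0)) :
    ∀ z, z = jetOver p a b →
      (charD2 V 0 2 2 z + ∑ i, (V p).1 i * z.2 0 (![0, 0, 2] + unitIndex i))
      - ε * ((charD3 V 0 2 0 0 z + ∑ i, (V p).1 i * z.2 0 (![2, 0, 1] + unitIndex i))
        + (charD3 V 0 2 1 1 z + ∑ i, (V p).1 i * z.2 0 (![0, 2, 1] + unitIndex i)))
      - γ * ((charD2 V 0 0 0 z + ∑ i, (V p).1 i * z.2 0 (![2, 0, 0] + unitIndex i))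
        + (charD2 V 0 1 1 z + ∑ i, (V p).1 i * z.2 0 (![0, 2, 0] + unitIndex i)))
      - (V p).2 1 = 0 := by
  rintro z rfl
  have hz : proj (jetOver p a b) ∈ M := by rwa [proj_jetOver]
  have h := equation_prolong hM hV.smooth ε γ hz
  rw [proj_jetOver] at h
  rw [← h, ← prolongApply_equation]
  refine hV.invariance _ hz ?_
  rw [equation_jetOver, ha]
  ring

attribute [local simp] charD2 charD3 jetD jetD2 jetD3 Fin.sum_univ_three totalVec_eq vertVec_eq
  proj_jetOver jetOver_snd_zero jetOver_snd_one unitIndex_ne_zero unitIndex_zero unitIndex_one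
  unitIndex_two

set_option maxHeartbeats 1000000 in
/-- The coefficient of `f_xxt` forces `ξ` and `φ₁` to be independent of `f`. -/
theorem IsInfinitesimalSymmetry.fderiv_fibreVec_one (hM : IsOpen M) (hε : ε ≠ 0)
    (hV : IsInfinitesimalSymmetry ε γ M V) {p : Total} (hp : p ∈ M) :
    fderiv ℝ (phi V 0) p (fibreVec 1) = 0 ∧
    fderiv ℝ (xi V 0) p (fibreVec 1) = 0 ∧
    fderiv ℝ (xi V 1) p (fibreVec 1) = 0 ∧
    fderiv ℝ (xi V 2) p (fibreVec 1) = 0 := by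
  -- Here `s` is `f_xxt` and `r` is the gradient of `u`. No other term of the equation is nonzero,
  -- so it forces `u_tt = f`, the value `p.2 1`.
  have key := fun (r : Fin 3 → ℝ) (s : ℝ) => hV.prolong_jetOver hM hp
    (fun i j k => if (i, j, k) = (1, 0, 0) then r 0 else if (i, j, k) = (0, 1, 0) then r 1 else
      if (i, j, k) = (0, 0, 1) then r 2 else if (i, j, k) = (0, 0, 2) then p.2 1 else 0)
    (fun i j k => if (i, j, k) = (2, 0, 1) then s else 0) (by simp) _ rfl
  simp at key
  -- The coefficient of `s` is affine in `r`; the origin and the three unit vectors determine it.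
  have h : ∀ r : Fin 3 → ℝ, fderiv ℝ (phi V 0) p (fibreVec 1) - (r 0
      * fderiv ℝ (xi V 0) p (fibreVec 1)
      + r 1 * fderiv ℝ (xi V 1) p (fibreVec 1) + r 2 * fderiv ℝ (xi V 2) p (fibreVec 1)) = 0 := by
    intro r
    refine (mul_eq_zero.1 ?_).resolve_left hε
    have h1 := key r 1
    have h0 := key r 0
    clear key
    linear_combination h0 - h1
  have h0 := h ![0, 0, 0]
  have h1 := h ![1, 0, 0]
  have h2 := h ![0, 1, 0]
  have h3 := h ![0, 0, 1]
  simp at h0 h1 h2 h3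
  refine ⟨?_, ?_, ?_, ?_⟩ <;> linarith

/-- The coefficient of `u_xxx`. -/
theorem IsInfinitesimalSymmetry.fderiv_xi_zero (hM : IsOpen M) (hε : ε ≠ 0)
    (hV : IsInfinitesimalSymmetry ε γ M V) {p : Total} (hp : p ∈ M) :
    fderiv ℝ (xi V 0) p (baseVec 2) = 0 ∧ fderiv ℝ (xi V 0) p (fibreVec 0) = 0 := by
  have key := fun r s : ℝ => hV.prolong_jetOver hM hp
    (fun i j k => if (i, j, k) = (3, 0, 0) then s else if (i, j, k) = (0, 0, 1) then r else
      if (i, j, k) = (0, 0, 2) then p.2 1 else 0)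
    0 (by simp) _ rfl
  simp at key
  -- This is `D_t ξ¹` at a jet with `u_t = r` and `f_t = 0`.
  have h : ∀ r : ℝ, fderiv ℝ (xi V 0) p (baseVec 2) + r * fderiv ℝ (xi V 0) p (fibreVec 0) = 0 := by
    intro r
    refine (mul_eq_zero.1 ?_).resolve_left hε
    linear_combination (key r 1 - key r 0)
  have h0 := h 0
  have h1 := h 1
  constructor <;> linarith

/-- The coefficient of `u_yyy`. -/
theorem IsInfinitesimalSymmetry.fderiv_xi_one (hM : IsOpen M) (hε : ε ≠ 0)
    (hV : IsInfinitesimalSymmetry ε γ M V) {p : Total} (hp : p ∈ M) :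
    fderiv ℝ (xi V 1) p (baseVec 2) = 0 ∧ fderiv ℝ (xi V 1) p (fibreVec 0) = 0 := by
  have key := fun r s : ℝ => hV.prolong_jetOver hM hp
    (fun i j k => if (i, j, k) = (0, 3, 0) then s else if (i, j, k) = (0, 0, 1) then r else
      if (i, j, k) = (0, 0, 2) then p.2 1 else 0)
    0 (by simp) _ rfl
  simp at key
  have h : ∀ r : ℝ, fderiv ℝ (xi V 1) p (baseVec 2) + r * fderiv ℝ (xi V 1) p (fibreVec 0) = 0 := by
    intro r
    refine (mul_eq_zero.1 ?_).resolve_left hε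
    linear_combination (key r 1 - key r 0)
  have h0 := h 0
  have h1 := h 1
  constructor <;> linarith

/-- The coefficient of `u_xtt`. -/
theorem IsInfinitesimalSymmetry.fderiv_xi_two (hM : IsOpen M) (hε : ε ≠ 0)
    (hV : IsInfinitesimalSymmetry ε γ M V) {p : Total} (hp : p ∈ M) :
    fderiv ℝ (xi V 2) p (baseVec 0) = 0 ∧ fderiv ℝ (xi V 2) p (fibreVec 0) = 0 := by
  have key := fun r s : ℝ => hV.prolong_jetOver hM hp
    (fun i j k => if (i, j, k) = (1, 0, 2) then s else if (i, j, k) = (1, 0, 0) then r else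
      if (i, j, k) = (0, 0, 2) then p.2 1 else 0)
    0 (by simp) _ rfl
  simp at key
  have h : ∀ r : ℝ, fderiv ℝ (xi V 2) p (baseVec 0) + r * fderiv ℝ (xi V 2) p (fibreVec 0) = 0 := by
    intro r
    refine (mul_eq_zero.1 ?_).resolve_left hε
    linear_combination (key r 1 - key r 0) / 2
  have h0 := h 0
  have h1 := h 1
  constructor <;> linarith

/-- The coefficient of `u_ytt`. -/
theorem IsInfinitesimalSymmetry.fderiv_xi_two_baseVec_one (hM : IsOpen M) (hε : ε ≠ 0)
    (hV : IsInfinitesimalSymmetry ε γ M V) {p : Total} (hp : p ∈ M) :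
    fderiv ℝ (xi V 2) p (baseVec 1) = 0 := by
  have key := fun s : ℝ => hV.prolong_jetOver hM hp
    (fun i j k => if (i, j, k) = (0, 1, 2) then s else if (i, j, k) = (0, 0, 2) then p.2 1 else 0)
    0 (by simp) _ rfl
  simp at key
  refine (mul_eq_zero.1 ?_).resolve_left hε
  linear_combination (key 1 - key 0) / 2

/-- The coefficient of `u_xyt`. -/
theorem IsInfinitesimalSymmetry.fderiv_xi_rotation (hM : IsOpen M) (hε : ε ≠ 0)
    (hV : IsInfinitesimalSymmetry ε γ M V) {p : Total} (hp : p ∈ M) :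
    fderiv ℝ (xi V 1) p (baseVec 0) = -1 * fderiv ℝ (xi V 0) p (baseVec 1) := by
  have key := fun s : ℝ => hV.prolong_jetOver hM hp
    (fun i j k => if (i, j, k) = (1, 1, 1) then s else if (i, j, k) = (0, 0, 2) then p.2 1 else 0)
    0 (by simp) _ rfl
  simp at key
  refine eq_of_sub_eq_zero ((mul_eq_zero.1 ?_).resolve_left hε)
  linear_combination (key 1 - key 0) / 2

/-- Collected as one rewriting set for the lower-order coefficients. -/
theorem IsInfinitesimalSymmetry.fderiv_xi_eq_zero (hM : IsOpen M) (hε : ε ≠ 0)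
    (hV : IsInfinitesimalSymmetry ε γ M V) {p : Total} (hp : p ∈ M) :
    fderiv ℝ (xi V 0) p (baseVec 2) = 0 ∧
    fderiv ℝ (xi V 0) p (fibreVec 0) = 0 ∧
    fderiv ℝ (xi V 1) p (baseVec 2) = 0 ∧
    fderiv ℝ (xi V 1) p (fibreVec 0) = 0 ∧
    fderiv ℝ (xi V 2) p (baseVec 0) = 0 ∧
    fderiv ℝ (xi V 2) p (baseVec 1) = 0 ∧
    fderiv ℝ (xi V 2) p (fibreVec 0) = 0 := by
  exact ⟨(hV.fderiv_xi_zero hM hε hp).1,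
    (hV.fderiv_xi_zero hM hε hp).2,
    (hV.fderiv_xi_one hM hε hp).1,
    (hV.fderiv_xi_one hM hε hp).2,
    (hV.fderiv_xi_two hM hε hp).1,
    hV.fderiv_xi_two_baseVec_one hM hε hp,
    (hV.fderiv_xi_two hM hε hp).2⟩

/-- The first-order identities hold on all of the open set `M`, so they may be differentiated. Both
orders of differentiation are recorded because both occur in the expanded prolongation. -/
theorem IsInfinitesimalSymmetry.fderiv_fderiv_xi_eq_zero (hM : IsOpen M) (hε : ε ≠ 0)
    (hV : IsInfinitesimalSymmetry ε γ M V)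
    {p : Total} (hp : p ∈ M) (v : Total) :
    (fderiv ℝ (fderiv ℝ (xi V 0)) p v (baseVec 2) = 0 ∧
      fderiv ℝ (fderiv ℝ (xi V 0)) p (baseVec 2) v = 0) ∧
    (fderiv ℝ (fderiv ℝ (xi V 0)) p v (fibreVec 0) = 0 ∧
      fderiv ℝ (fderiv ℝ (xi V 0)) p (fibreVec 0) v = 0) ∧
    (fderiv ℝ (fderiv ℝ (xi V 1)) p v (baseVec 2) = 0 ∧
      fderiv ℝ (fderiv ℝ (xi V 1)) p (baseVec 2) v = 0) ∧
    (fderiv ℝ (fderiv ℝ (xi V 1)) p v (fibreVec 0) = 0 ∧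
      fderiv ℝ (fderiv ℝ (xi V 1)) p (fibreVec 0) v = 0) ∧
    (fderiv ℝ (fderiv ℝ (xi V 2)) p v (baseVec 0) = 0 ∧
      fderiv ℝ (fderiv ℝ (xi V 2)) p (baseVec 0) v = 0) ∧
    (fderiv ℝ (fderiv ℝ (xi V 2)) p v (baseVec 1) = 0 ∧
      fderiv ℝ (fderiv ℝ (xi V 2)) p (baseVec 1) v = 0) ∧
    (fderiv ℝ (fderiv ℝ (xi V 2)) p v (fibreVec 0) = 0 ∧
      fderiv ℝ (fderiv ℝ (xi V 2)) p (fibreVec 0) v = 0) := by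
  have hs := contDiffOn_fst_comp hV.smooth
  refine ⟨⟨?_, ?_⟩, ⟨?_, ?_⟩, ⟨?_, ?_⟩, ⟨?_, ?_⟩, ⟨?_, ?_⟩, ⟨?_, ?_⟩, ⟨?_, ?_⟩⟩
  · exact fderiv_fderiv_eq_zero hM (hs 0) (fun p hp => (hV.fderiv_xi_zero hM hε hp).1) hp v
  · exact fderiv_fderiv_eq_zero_left hM (hs 0) (fun p hp => (hV.fderiv_xi_zero hM hε hp).1) hp v
  · exact fderiv_fderiv_eq_zero hM (hs 0) (fun p hp => (hV.fderiv_xi_zero hM hε hp).2) hp v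
  · exact fderiv_fderiv_eq_zero_left hM (hs 0) (fun p hp => (hV.fderiv_xi_zero hM hε hp).2) hp v
  · exact fderiv_fderiv_eq_zero hM (hs 1) (fun p hp => (hV.fderiv_xi_one hM hε hp).1) hp v
  · exact fderiv_fderiv_eq_zero_left hM (hs 1) (fun p hp => (hV.fderiv_xi_one hM hε hp).1) hp v
  · exact fderiv_fderiv_eq_zero hM (hs 1) (fun p hp => (hV.fderiv_xi_one hM hε hp).2) hp v
  · exact fderiv_fderiv_eq_zero_left hM (hs 1) (fun p hp => (hV.fderiv_xi_one hM hε hp).2) hp v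
  · exact fderiv_fderiv_eq_zero hM (hs 2) (fun p hp => (hV.fderiv_xi_two hM hε hp).1) hp v
  · exact fderiv_fderiv_eq_zero_left hM (hs 2) (fun p hp => (hV.fderiv_xi_two hM hε hp).1) hp v
  · exact fderiv_fderiv_eq_zero hM (hs 2) (fun p hp => hV.fderiv_xi_two_baseVec_one hM hε hp) hp v
  · exact fderiv_fderiv_eq_zero_left hM (hs 2) (fun p hp
      => hV.fderiv_xi_two_baseVec_one hM hε hp) hp v
  · exact fderiv_fderiv_eq_zero hM (hs 2) (fun p hp => (hV.fderiv_xi_two hM hε hp).2) hp v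
  · exact fderiv_fderiv_eq_zero_left hM (hs 2) (fun p hp => (hV.fderiv_xi_two hM hε hp).2) hp v

/-- The coefficients of `u_xt` and `u_x u_xt`. -/
theorem IsInfinitesimalSymmetry.fderiv_fderiv_phi_fibreVec_zero (hM : IsOpen M) (hε : ε ≠ 0)
    (hV : IsInfinitesimalSymmetry ε γ M V) {p : Total} (hp : p ∈ M) :
    2 * fderiv ℝ (fderiv ℝ (phi V 0)) p (baseVec 0) (fibreVec 0)
      = fderiv ℝ (fderiv ℝ (xi V 0)) p (baseVec 0) (baseVec 0)
      + fderiv ℝ (fderiv ℝ (xi V 0)) p (baseVec 1) (baseVec 1) ∧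
    fderiv ℝ (fderiv ℝ (phi V 0)) p (fibreVec 0) (fibreVec 0) = 0 := by
  have key := fun r s : ℝ => hV.prolong_jetOver hM hp
    (fun i j k => if (i, j, k) = (1, 0, 1) then s else if (i, j, k) = (1, 0, 0) then r else
      if (i, j, k) = (0, 0, 2) then p.2 1 else 0)
    0 (by simp) _ rfl
  simp [hV.fderiv_xi_eq_zero hM hε hp,
    hV.fderiv_fderiv_xi_eq_zero hM hε hp] at key
  have h : ∀ r : ℝ, 2 * (fderiv ℝ (fderiv ℝ (phi V 0)) p (baseVec 0) (fibreVec 0) + r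
      * fderiv ℝ (fderiv ℝ (phi V 0)) p (fibreVec 0) (fibreVec 0))
      - (fderiv ℝ (fderiv ℝ (xi V 0)) p (baseVec 0) (baseVec 0)
        + fderiv ℝ (fderiv ℝ (xi V 0)) p (baseVec 1) (baseVec 1)) = 0 := by
    intro r
    refine (mul_eq_zero.1 ?_).resolve_left hε
    linear_combination key r 0 - key r 1
  have h0 := h 0
  have h1 := h 1
  constructor <;> linarith

/-- The coefficient of `u_yt`. -/
theorem IsInfinitesimalSymmetry.fderiv_fderiv_phi_baseVec_one (hM : IsOpen M) (hε : ε ≠ 0)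
    (hV : IsInfinitesimalSymmetry ε γ M V) {p : Total} (hp : p ∈ M) :
    2 * fderiv ℝ (fderiv ℝ (phi V 0)) p (baseVec 1) (fibreVec 0)
      = fderiv ℝ (fderiv ℝ (xi V 1)) p (baseVec 0) (baseVec 0)
      + fderiv ℝ (fderiv ℝ (xi V 1)) p (baseVec 1) (baseVec 1) := by
  have key := fun s : ℝ => hV.prolong_jetOver hM hp
    (fun i j k => if (i, j, k) = (0, 1, 1) then s else if (i, j, k) = (0, 0, 2) then p.2 1 else 0)
    0 (by simp) _ rfl
  simp [hV.fderiv_xi_eq_zero hM hε hp,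
    hV.fderiv_fderiv_xi_eq_zero hM hε hp] at key
  refine eq_of_sub_eq_zero ((mul_eq_zero.1 ?_).resolve_left hε)
  linear_combination key 0 - key 1

/-- The coefficient of `u_xxt` on solutions. -/
theorem IsInfinitesimalSymmetry.fderiv_xi_zero_diag (hM : IsOpen M) (hε : ε ≠ 0)
    (hV : IsInfinitesimalSymmetry ε γ M V) {p : Total} (hp : p ∈ M) :
    fderiv ℝ (xi V 0) p (baseVec 0) = 1 / 2 * fderiv ℝ (xi V 2) p (baseVec 2) := by
  have key := fun s : ℝ => hV.prolong_jetOver hM hp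
    -- Unlike the earlier third-order coordinates, `u_xxt` occurs in the equation, so `u_tt` must
    -- move by `ε * s`.
    (fun i j k => if (i, j, k) = (2, 0, 1) then s else
      if (i, j, k) = (0, 0, 2) then p.2 1 + ε * s else 0)
    0 (by simp) _ rfl
  simp [hV.fderiv_fderiv_xi_eq_zero hM hε hp] at key
  refine eq_of_sub_eq_zero ((mul_eq_zero.1 ?_).resolve_left hε)
  linear_combination (key 1 - key 0) / 2

/-- The coefficient of `u_yyt` on solutions. -/
theorem IsInfinitesimalSymmetry.fderiv_xi_one_diag (hM : IsOpen M) (hε : ε ≠ 0)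
    (hV : IsInfinitesimalSymmetry ε γ M V) {p : Total} (hp : p ∈ M) :
    fderiv ℝ (xi V 1) p (baseVec 1) = 1 / 2 * fderiv ℝ (xi V 2) p (baseVec 2) := by
  have key := fun s : ℝ => hV.prolong_jetOver hM hp
    (fun i j k => if (i, j, k) = (0, 2, 1) then s else
      if (i, j, k) = (0, 0, 2) then p.2 1 + ε * s else 0)
    0 (by simp) _ rfl
  simp [hV.fderiv_fderiv_xi_eq_zero hM hε hp] at key
  refine eq_of_sub_eq_zero ((mul_eq_zero.1 ?_).resolve_left hε)
  linear_combination (key 1 - key 0) / 2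

/-- The coefficient of `u_xx` on solutions. -/
theorem IsInfinitesimalSymmetry.fderiv_fderiv_phi_baseVec_two (hM : IsOpen M) (hε : ε ≠ 0)
    (hV : IsInfinitesimalSymmetry ε γ M V) {p : Total} (hp : p ∈ M) :
    ε * fderiv ℝ (fderiv ℝ (phi V 0)) p (fibreVec 0) (baseVec 2)
      = 2 * γ * (fderiv ℝ (xi V 0) p (baseVec 0) - fderiv ℝ (xi V 2) p (baseVec 2)) := by
  have key := fun s : ℝ => hV.prolong_jetOver hM hp
    (fun i j k => if (i, j, k) = (2, 0, 0) then s else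
      if (i, j, k) = (0, 0, 2) then p.2 1 + γ * s else 0)
    0 (by simp) _ rfl
  simp [hV.fderiv_xi_eq_zero hM hε hp,
    hV.fderiv_fderiv_xi_eq_zero hM hε hp] at key
  linear_combination key 0 - key 1

/-- Differentiate `ξ¹_x = ξ²_y = ξ³_t / 2` and `ξ²_x = -ξ¹_y`. The `t`-derivative of the first gives
`ξ³_tt = 0`, its `x`- and `y`-derivatives kill the second derivatives containing `ξ¹_x` or `ξ²_y`,
and the rotation identity with symmetry handles the rest. -/
theorem IsInfinitesimalSymmetry.fderiv_fderiv_xi_diag (hM : IsOpen M) (hε : ε ≠ 0)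
    (hV : IsInfinitesimalSymmetry ε γ M V) {p : Total} (hp : p ∈ M) :
    fderiv ℝ (fderiv ℝ (xi V 2)) p (baseVec 2) (baseVec 2) = 0 ∧
    fderiv ℝ (fderiv ℝ (xi V 0)) p (baseVec 0) (baseVec 0) = 0 ∧
    fderiv ℝ (fderiv ℝ (xi V 0)) p (baseVec 1) (baseVec 0) = 0 ∧
    fderiv ℝ (fderiv ℝ (xi V 0)) p (baseVec 1) (baseVec 1) = 0 ∧
    fderiv ℝ (fderiv ℝ (xi V 1)) p (baseVec 0) (baseVec 0) = 0 ∧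
    fderiv ℝ (fderiv ℝ (xi V 1)) p (baseVec 1) (baseVec 1) = 0 := by
  have hs := contDiffOn_fst_comp hV.smooth
  have h0 := fderiv_fderiv_eq_mul hM (hs 0) (hs 2)
    (fun p hp => hV.fderiv_xi_zero_diag hM hε hp) hp
  have h1 := fderiv_fderiv_eq_mul hM (hs 1) (hs 2)
    (fun p hp => hV.fderiv_xi_one_diag hM hε hp) hp
  have h2 := fderiv_fderiv_eq_mul hM (hs 1) (hs 0)
    (fun p hp => hV.fderiv_xi_rotation hM hε hp) hp
  have hz := hV.fderiv_fderiv_xi_eq_zero hM hε hp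
  have c0 := fderiv_fderiv_comm hM (hs 0) hp (baseVec 0) (baseVec 1)
  have c1 := fderiv_fderiv_comm hM (hs 1) hp (baseVec 0) (baseVec 1)
  have e0 := h0 (baseVec 2)
  have e1 := h0 (baseVec 0)
  have e2 := h0 (baseVec 1)
  have e3 := h1 (baseVec 0)
  have e4 := h1 (baseVec 1)
  have e5 := h2 (baseVec 0)
  have e6 := h2 (baseVec 1)
  simp only [hz, mul_zero] at e0 e1 e2 e3 e4
  refine ⟨?_, ?_, ?_, ?_, ?_, ?_⟩ <;> linarith

theorem IsInfinitesimalSymmetry.fderiv_fderiv_phi_space (hM : IsOpen M) (hε : ε ≠ 0)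
    (hV : IsInfinitesimalSymmetry ε γ M V) {p : Total} (hp : p ∈ M) :
    fderiv ℝ (fderiv ℝ (phi V 0)) p (baseVec 0) (fibreVec 0) = 0 ∧
    fderiv ℝ (fderiv ℝ (phi V 0)) p (baseVec 1) (fibreVec 0) = 0 := by
  obtain ⟨-, h1, -, h2, h3, h4⟩ := hV.fderiv_fderiv_xi_diag hM hε hp
  have h5 := (hV.fderiv_fderiv_phi_fibreVec_zero hM hε hp).1
  have h6 := hV.fderiv_fderiv_phi_baseVec_one hM hε hp
  constructor <;> linarith

/-- The coefficient of `u_t`. -/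
theorem IsInfinitesimalSymmetry.fderiv_fderiv_phi_time (hM : IsOpen M) (hε : ε ≠ 0)
    (hV : IsInfinitesimalSymmetry ε γ M V) {p : Total} (hp : p ∈ M) :
    fderiv ℝ (fderiv ℝ (phi V 0)) p (baseVec 2) (fibreVec 0) = 0 := by
  have hs := contDiffOn_fst_comp hV.smooth 2
  have hp0 := contDiffOn_snd_comp hV.smooth 0
  have hx := fderiv_fderiv_fderiv_eq_zero hM hp0
    (fun p hp => (hV.fderiv_fderiv_phi_space hM hε hp).1) hp (baseVec 0)
  have hy := fderiv_fderiv_fderiv_eq_zero hM hp0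
    (fun p hp => (hV.fderiv_fderiv_phi_space hM hε hp).2) hp (baseVec 1)
  have hx' := fun v w => fderiv_fderiv_fderiv_eq_zero hM hs (fun p hp =>
    (hV.fderiv_fderiv_xi_eq_zero hM hε hp w).2.2.2.2.1.2) hp v
  have hy' := fun v w => fderiv_fderiv_fderiv_eq_zero hM hs (fun p hp =>
    (hV.fderiv_fderiv_xi_eq_zero hM hε hp w).2.2.2.2.2.1.2) hp v
  have hu := fderiv_fderiv_comm hM hp0 hp (baseVec 2) (fibreVec 0)
  have hd := hV.fderiv_fderiv_xi_diag hM hε hp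
  have huu := (hV.fderiv_fderiv_phi_fibreVec_zero hM hε hp).2
  have key := fun s : ℝ => hV.prolong_jetOver hM hp
    (fun i j k => if (i, j, k) = (0, 0, 1) then s else if (i, j, k) = (0, 0, 2) then p.2 1 else 0)
    0 (by simp) _ rfl
  simp [hV.fderiv_xi_eq_zero hM hε hp,
    hV.fderiv_fderiv_xi_eq_zero hM hε hp,
    hx, hy, hx', hy', hd, huu] at key
  -- The coefficient of `u_t` contains the mixed derivative in both orders; `hu` identifies them.
  linear_combination (key 1 - key 0) / 2 + hu / 2

/-- With `φ₁_tu = 0` and `ξ¹_x = ξ³_t / 2`, the `u_xx` identity reduces to `γ ξ³_t = 0`. Only this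
step excludes the scaling. -/
theorem IsInfinitesimalSymmetry.fderiv_xi_two_baseVec_two (hM : IsOpen M) (hε : ε ≠ 0) (hγ : γ ≠ 0)
    (hV : IsInfinitesimalSymmetry ε γ M V) {p : Total} (hp : p ∈ M) :
    fderiv ℝ (xi V 2) p (baseVec 2) = 0 := by
  have h1 := hV.fderiv_fderiv_phi_time hM hε hp
  have h2 := hV.fderiv_fderiv_phi_baseVec_two hM hε hp
  rw [fderiv_fderiv_comm hM (contDiffOn_snd_comp hV.smooth 0) hp, h1,
    hV.fderiv_xi_zero_diag hM hε hp] at h2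
  refine (mul_eq_zero.1 ?_).resolve_left hγ
  linear_combination h2

/-- The part of the symmetry condition free of derivatives of `u` and `f`. -/
theorem IsInfinitesimalSymmetry.phi_one_eq (hM : IsOpen M) (hε : ε ≠ 0) (hγ : γ ≠ 0)
    (hV : IsInfinitesimalSymmetry ε γ M V) {p : Total} (hp : p ∈ M) :
    (V p).2 1 = p.2 1 * fderiv ℝ (phi V 0) p (fibreVec 0)
      + fderiv ℝ (fderiv ℝ (phi V 0)) p (baseVec 2) (baseVec 2)
      - ε * (fderiv ℝ (fderiv ℝ (fderiv ℝ (phi V 0))) p (baseVec 0) (baseVec 0) (baseVec 2)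
        + fderiv ℝ (fderiv ℝ (fderiv ℝ (phi V 0))) p (baseVec 1) (baseVec 1) (baseVec 2))
      - γ * (fderiv ℝ (fderiv ℝ (phi V 0)) p (baseVec 0) (baseVec 0)
        + fderiv ℝ (fderiv ℝ (phi V 0)) p (baseVec 1) (baseVec 1)) := by
  have ht := hV.fderiv_xi_two_baseVec_two hM hε hγ hp
  have key := hV.prolong_jetOver hM hp
    (fun i j k => if (i, j, k) = (0, 0, 2) then p.2 1 else 0)
    0 (by simp) _ rfl
  simp [hV.fderiv_fderiv_xi_eq_zero hM hε hp, ht] at key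
  linear_combination -key

end Determining

/-! ### Integrating the determining equations -/

theorem eq_sum_coordVec (v : Total) :
    v = v.1 0 • baseVec 0 + v.1 1 • baseVec 1 + v.1 2 • baseVec 2 + v.2 0 • fibreVec 0
      + v.2 1 • fibreVec 1 := by
  ext i <;> fin_cases i <;> simp [baseVec, fibreVec]

/-- Two continuous linear forms on the total space agreeing on the coordinate vectors agree. -/
theorem clm_ext_coordVec {L L' : Total →L[ℝ] ℝ} (h0 : L (baseVec 0) = L' (baseVec 0))
    (h1 : L (baseVec 1) = L' (baseVec 1)) (h2 : L (baseVec 2) = L' (baseVec 2))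
    (h3 : L (fibreVec 0) = L' (fibreVec 0)) (h4 : L (fibreVec 1) = L' (fibreVec 1)) :
    L = L' := by
  refine ContinuousLinearMap.ext fun v => ?_
  rw [eq_sum_coordVec v]
  simp only [map_add, map_smul, h0, h1, h2, h3, h4]

/-- The `i`-th base coordinate as a linear form on the total space. -/
def baseForm (i : Fin 3) : Total →L[ℝ] ℝ :=
  (ContinuousLinearMap.proj (R := ℝ) (φ := fun _ : Fin 3 => ℝ) i).comp
    (ContinuousLinearMap.fst ℝ Base Fibre)

/-- The `α`-th fibre coordinate as a linear form on the total space. -/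
def fibreForm (α : Fin 2) : Total →L[ℝ] ℝ :=
  (ContinuousLinearMap.proj (R := ℝ) (φ := fun _ : Fin 2 => ℝ) α).comp
    (ContinuousLinearMap.snd ℝ Base Fibre)

theorem baseForm_apply (i : Fin 3) (p : Total) : baseForm i p = p.1 i := rfl

theorem fibreForm_apply (α : Fin 2) (p : Total) : fibreForm α p = p.2 α := rfl

theorem exists_eq_add_const {E : Type*} [NormedAddCommGroup E] [NormedSpace ℝ E] {s : Set E}
    {h : E → ℝ} (hs : IsOpen s) (hc : IsPreconnected s) (hh : DifferentiableOn ℝ h s)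
    {L : E →L[ℝ] ℝ} (hL : ∀ p ∈ s, fderiv ℝ h p = L) : ∃ c, ∀ p ∈ s, h p = L p + c := by
  obtain ⟨c, hc'⟩ := hs.exists_eq_add_of_fderiv_eq hc hh L.differentiable.differentiableOn
    (fun p hp => by rw [hL p hp, L.fderiv])
  exact ⟨c, hc'⟩

section Integration

variable {M : Set Total}

theorem exists_eq_const_of_fderiv_fderiv (hM : IsOpen M) (hc : IsPreconnected M)
    {h : Total → ℝ} (hh : ContDiffOn ℝ ∞ h M) {w : Total}
    (h0 : ∀ p ∈ M, fderiv ℝ (fderiv ℝ h) p (baseVec 0) w = 0)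
    (h1 : ∀ p ∈ M, fderiv ℝ (fderiv ℝ h) p (baseVec 1) w = 0)
    (h2 : ∀ p ∈ M, fderiv ℝ (fderiv ℝ h) p (baseVec 2) w = 0)
    (h3 : ∀ p ∈ M, fderiv ℝ (fderiv ℝ h) p (fibreVec 0) w = 0)
    (h4 : ∀ p ∈ M, fderiv ℝ (fderiv ℝ h) p (fibreVec 1) w = 0) :
    ∃ c, ∀ p ∈ M, fderiv ℝ h p w = c := by
  have hd : DifferentiableOn ℝ (fun p => fderiv ℝ h p w) M := fun p hp =>
    ((differentiableAt_of_contDiffOn hM (contDiffOn_fderiv hM hh) hp).clm_apply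
      (differentiableAt_const w)).differentiableWithinAt
  obtain ⟨c, hc'⟩ := exists_eq_add_const hM hc hd (L := 0) (by
    intro p hp
    apply clm_ext_coordVec <;> rw [← fderiv_fderiv_apply hM hh hp]
    exacts [h0 p hp, h1 p hp, h2 p hp, h3 p hp, h4 p hp])
  exact ⟨c, fun p hp => by simpa using hc' p hp⟩

theorem isOpen_image_fst (hM : IsOpen M) : IsOpen (Prod.fst '' M) := isOpenMap_fst M hM

/-- A smooth function with vertical derivatives `∂h/∂u = c` and `∂h/∂f = 0` on an open set with
connected fibres is `c u` plus a smooth function of the base point. -/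
theorem exists_eq_add_comp_fst (hM : IsOpen M)
    (hfib : ∀ q : Base, IsPreconnected {w : Fibre | (q, w) ∈ M})
    {h : Total → ℝ} (hh : ContDiffOn ℝ ∞ h M) {c : ℝ}
    (hu : ∀ p ∈ M, fderiv ℝ h p (fibreVec 0) = c)
    (hf : ∀ p ∈ M, fderiv ℝ h p (fibreVec 1) = 0) :
    ∃ F : Base → ℝ, ContDiffOn ℝ ∞ F (Prod.fst '' M) ∧ ∀ p ∈ M, h p = c * p.2 0 + F p.1 := by
  have hconst : ∀ q : Base, ∃ d : ℝ, ∀ w : Fibre, (q, w) ∈ M → h (q, w) = c * w 0 + d := by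
    intro q
    have hι : ∀ w : Fibre, HasFDerivAt (fun w : Fibre => ((q, w) : Total))
        (ContinuousLinearMap.inr ℝ Base Fibre) w := fun w => hasFDerivAt_prodMk_right q w
    have hd : ∀ w ∈ {w : Fibre | (q, w) ∈ M}, HasFDerivAt (fun w : Fibre => h (q, w))
        ((fderiv ℝ h (q, w)).comp (ContinuousLinearMap.inr ℝ Base Fibre)) w := fun w hw =>
      (differentiableAt_of_contDiffOn hM hh hw).hasFDerivAt.comp w (hι w)
    obtain ⟨d, hd'⟩ := exists_eq_add_const
      (L := c • ContinuousLinearMap.proj (R := ℝ) (φ := fun _ : Fin 2 => ℝ) 0)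
      (hM.preimage (by fun_prop : Continuous fun w : Fibre => ((q, w) : Total))) (hfib q)
      (fun w hw => (hd w hw).differentiableAt.differentiableWithinAt) (by
        intro w hw
        rw [(hd w hw).fderiv]
        ext v
        have hv : ((0, v) : Total) = v 0 • fibreVec 0 + v 1 • fibreVec 1 := by
          ext i
          · simp [fibreVec]
          · fin_cases i <;> simp [fibreVec]
        simp [hv, hu _ hw, hf _ hw, mul_comm])
    exact ⟨d, fun w hw => by simpa using hd' w hw⟩
  choose F hF using hconst
  refine ⟨F, ?_, fun p hp => hF p.1 p.2 hp⟩
  rintro _ ⟨p, hp, rfl⟩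
  -- Smoothness of `F` near `p.1`: since `M` is open, the height `p.2` stays admissible for nearby
  -- `q`, and there `F q` equals `h (q, p.2) - c * p.2 0`.
  have hι : ContDiff ℝ ∞ fun q : Base => ((q, p.2) : Total) := by fun_prop
  have h1 : ContDiffAt ℝ ∞ (fun q : Base => h (q, p.2) - c * p.2 0) p.1 :=
    ((hh.contDiffAt (hM.mem_nhds hp)).comp p.1 hι.contDiffAt).sub contDiffAt_const
  refine (h1.congr_of_eventuallyEq ?_).contDiffWithinAt
  filter_upwards [hι.continuous.continuousAt.eventually_mem (hM.mem_nhds hp)] with q hq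
  rw [hF q p.2 hq]
  ring

end Integration

/-! ### Derivatives of a fibre coordinate multiple plus a function of the base -/

section Split

variable {M : Set Total} {h : Total → ℝ} {F : Base → ℝ} {c : ℝ} {α : Fin 2}

theorem contDiffOn_add_comp_fst (hF : ContDiffOn ℝ ∞ F (Prod.fst '' M))
    (hh : ∀ p ∈ M, h p = c * p.2 α + F p.1) : ContDiffOn ℝ ∞ h M := by
  refine ContDiffOn.congr ?_ hh
  exact (by fun_prop : ContDiff ℝ ∞ fun p : Total => c * p.2 α).contDiffOn.add
    (hF.comp contDiff_fst.contDiffOn (Set.mapsTo_image _ _))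

theorem fderiv_const_add_comp_fst {G : Base → ℝ} {p : Total} (hG : DifferentiableAt ℝ G p.1)
    (L : Total →L[ℝ] ℝ) (d : ℝ) (v : Total) :
    fderiv ℝ (fun p : Total => L p + d + G p.1) p v = L v + fderiv ℝ G p.1 v.1 := by
  have h := (L.hasFDerivAt (x := p)).add_const d |>.add
    (hG.hasFDerivAt.comp p (hasFDerivAt_fst (𝕜 := ℝ) (E := Base) (F := Fibre)))
  have h' : HasFDerivAt (fun p : Total => L p + d + G p.1)
    (L + (fderiv ℝ G p.1).comp (ContinuousLinearMap.fst ℝ Base Fibre)) p := h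
  rw [h'.fderiv]
  rfl

theorem fderiv_split (hM : IsOpen M) (hF : ContDiffOn ℝ ∞ F (Prod.fst '' M))
    (hh : ∀ p ∈ M, h p = c * p.2 α + F p.1) {p : Total} (hp : p ∈ M) (v : Total) :
    fderiv ℝ h p v = c * v.2 α + fderiv ℝ F p.1 v.1 := by
  have hd := differentiableAt_of_contDiffOn (isOpen_image_fst hM) hF ⟨p, hp, rfl⟩
  rw [fderiv_congr_of_eqOn hM (g := fun p : Total => (c • fibreForm α) p + 0 + F p.1)
    (fun p hp => by simpa [fibreForm_apply] using hh p hp) hp, fderiv_const_add_comp_fst hd]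
  rfl

theorem fderiv_fderiv_split (hM : IsOpen M) (hF : ContDiffOn ℝ ∞ F (Prod.fst '' M))
    (hh : ∀ p ∈ M, h p = c * p.2 α + F p.1) {p : Total} (hp : p ∈ M) (v w : Total) :
    fderiv ℝ (fderiv ℝ h) p v w = fderiv ℝ (fderiv ℝ F) p.1 v.1 w.1 := by
  have hΩ := isOpen_image_fst hM
  have hpΩ : p.1 ∈ Prod.fst '' M := ⟨p, hp, rfl⟩
  have hd : DifferentiableAt ℝ (fun q => fderiv ℝ F q w.1) p.1 :=
    (differentiableAt_of_contDiffOn hΩ (contDiffOn_fderiv hΩ hF) hpΩ).clm_apply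
      (differentiableAt_const _)
  rw [fderiv_fderiv_apply hM (contDiffOn_add_comp_fst hF hh) hp, fderiv_fderiv_apply hΩ hF hpΩ,
    fderiv_congr_of_eqOn hM
      (g := fun p : Total => (0 : Total →L[ℝ] ℝ) p + c * w.2 α + fderiv ℝ F p.1 w.1)
      (fun p hp => by simpa using fderiv_split hM hF hh hp w) hp,
    fderiv_const_add_comp_fst (G := fun q => fderiv ℝ F q w.1) hd]
  simp

theorem fderiv_fderiv_fderiv_split (hM : IsOpen M) (hF : ContDiffOn ℝ ∞ F (Prod.fst '' M))
    (hh : ∀ p ∈ M, h p = c * p.2 α + F p.1) {p : Total} (hp : p ∈ M) (v w w' : Total) :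
    fderiv ℝ (fderiv ℝ (fderiv ℝ h)) p v w w'
      = fderiv ℝ (fderiv ℝ (fderiv ℝ F)) p.1 v.1 w.1 w'.1 := by
  have hΩ := isOpen_image_fst hM
  have hpΩ : p.1 ∈ Prod.fst '' M := ⟨p, hp, rfl⟩
  have hd : DifferentiableAt ℝ (fun q => fderiv ℝ (fderiv ℝ F) q w.1 w'.1) p.1 :=
    ((differentiableAt_of_contDiffOn hΩ (contDiffOn_fderiv hΩ (contDiffOn_fderiv hΩ hF))
      hpΩ).clm_apply (differentiableAt_const _)).clm_apply (differentiableAt_const _)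
  rw [fderiv_fderiv_fderiv_apply hM (contDiffOn_add_comp_fst hF hh) hp,
    fderiv_fderiv_fderiv_apply hΩ hF hpΩ, fderiv_congr_of_eqOn hM
      (g := fun p : Total =>
        (0 : Total →L[ℝ] ℝ) p + 0 + fderiv ℝ (fderiv ℝ F) p.1 w.1 w'.1)
      (fun p hp => by simpa using fderiv_fderiv_split hM hF hh hp w w') hp,
    fderiv_const_add_comp_fst (G := fun q => fderiv ℝ (fderiv ℝ F) q w.1 w'.1) hd]
  simp

end Split

/-! ### Partial derivatives and the viscoelastic operator on the base -/

section BaseOperators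

variable {s : Set Base} {F G : Base → ℝ}

theorem contDiffOn_pderiv (hs : IsOpen s) (hF : ContDiffOn ℝ ∞ F s) (k : Fin 3) :
    ContDiffOn ℝ ∞ (pderiv k F) s :=
  (contDiffOn_fderiv hs hF).clm_apply contDiffOn_const

theorem pderiv_congr (hs : IsOpen s) (hFG : Set.EqOn F G s) (k : Fin 3) :
    Set.EqOn (pderiv k F) (pderiv k G) s := by
  intro q hq
  rw [pderiv, pderiv, fderiv_congr_of_eqOn hs hFG hq]

theorem pderiv_pderiv (hs : IsOpen s) (hF : ContDiffOn ℝ ∞ F s) (k l : Fin 3) {q : Base}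
    (hq : q ∈ s) : pderiv k (pderiv l F) q
      = fderiv ℝ (fderiv ℝ F) q (Pi.single k 1) (Pi.single l 1) :=
  (fderiv_fderiv_apply hs hF hq _ _).symm

theorem pderiv_comm (hs : IsOpen s) (hF : ContDiffOn ℝ ∞ F s) (k l : Fin 3) :
    Set.EqOn (pderiv k (pderiv l F)) (pderiv l (pderiv k F)) s := by
  intro q hq
  rw [pderiv_pderiv hs hF _ _ hq, pderiv_pderiv hs hF _ _ hq, fderiv_fderiv_comm hs hF hq]

theorem pderiv_pderiv_pderiv (hs : IsOpen s) (hF : ContDiffOn ℝ ∞ F s) (k l m : Fin 3)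
    {q : Base} (hq : q ∈ s) : pderiv k (pderiv l (pderiv m F)) q
      = fderiv ℝ (fderiv ℝ (fderiv ℝ F)) q (Pi.single k 1) (Pi.single l 1) (Pi.single m 1) := by
  rw [pderiv_congr hs (fun x hx => pderiv_pderiv hs hF l m hx) k hq,
    fderiv_fderiv_fderiv_apply hs hF hq]
  rfl

theorem pderiv_add (hs : IsOpen s) (hF : ContDiffOn ℝ ∞ F s) (hG : ContDiffOn ℝ ∞ G s)
    (k : Fin 3) {q : Base} (hq : q ∈ s) :
    pderiv k (fun x => F x + G x) q = pderiv k F q + pderiv k G q := by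
  rw [pderiv, fderiv_fun_add (differentiableAt_of_contDiffOn hs hF hq)
    (differentiableAt_of_contDiffOn hs hG hq)]
  rfl

theorem viscoOp_eq (hs : IsOpen s) (hF : ContDiffOn ℝ ∞ F s) (ε γ : ℝ) {q : Base}
    (hq : q ∈ s) : viscoOp ε γ F q =
      pderiv 2 (pderiv 2 F) q - ε * (pderiv 2 (pderiv 0 (pderiv 0 F)) q
        + pderiv 2 (pderiv 1 (pderiv 1 F)) q)
      - γ * (pderiv 0 (pderiv 0 F) q + pderiv 1 (pderiv 1 F) q) := by
  have h := pderiv_add hs (contDiffOn_pderiv hs (contDiffOn_pderiv hs hF 0) 0)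
    (contDiffOn_pderiv hs (contDiffOn_pderiv hs hF 1) 1) 2 hq
  rw [viscoOp, ← h]
  rfl

/-- The operator `viscoOp` in terms of higher Fréchet derivatives. -/
theorem viscoOp_eq_fderiv (hs : IsOpen s) (hF : ContDiffOn ℝ ∞ F s) (ε γ : ℝ) {q : Base}
    (hq : q ∈ s) : viscoOp ε γ F q =
      fderiv ℝ (fderiv ℝ F) q (Pi.single 2 1) (Pi.single 2 1)
      - ε * (fderiv ℝ (fderiv ℝ (fderiv ℝ F)) q (Pi.single 0 1) (Pi.single 0 1) (Pi.single 2 1)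
        + fderiv ℝ (fderiv ℝ (fderiv ℝ F)) q (Pi.single 1 1) (Pi.single 1 1) (Pi.single 2 1))
      - γ * (fderiv ℝ (fderiv ℝ F) q (Pi.single 0 1) (Pi.single 0 1)
        + fderiv ℝ (fderiv ℝ F) q (Pi.single 1 1) (Pi.single 1 1)) := by
  -- The time derivative is moved innermost, to match the order in which the prolongation
  -- differentiates.
  have hc : ∀ k : Fin 3, pderiv 2 (pderiv k (pderiv k F)) q
      = fderiv ℝ (fderiv ℝ (fderiv ℝ F)) q (Pi.single k 1) (Pi.single k 1) (Pi.single 2 1) := by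
    intro k
    rw [pderiv_comm hs (contDiffOn_pderiv hs hF k) 2 k hq,
      pderiv_congr hs (pderiv_comm hs hF 2 k) k hq, pderiv_pderiv_pderiv hs hF _ _ _ hq]
  rw [viscoOp_eq hs hF ε γ hq, hc, hc, pderiv_pderiv hs hF _ _ hq, pderiv_pderiv hs hF _ _ hq,
    pderiv_pderiv hs hF _ _ hq]

end BaseOperators

/-! ### Every symmetry is a generator -/

section Forward

variable {ε γ : ℝ} {M : Set Total} {V : Total → Total}

theorem IsInfinitesimalSymmetry.exists_generator (hε : ε ≠ 0) (hγ : γ ≠ 0)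
    (hM : IsOpen M) (hconn : IsPreconnected M)
    (hfib : ∀ q : Base, IsPreconnected {w : Fibre | (q, w) ∈ M})
    (hV : IsInfinitesimalSymmetry ε γ M V) :
    ∃ (c₁ c₂ c₃ c₄ c₅ : ℝ) (F : Base → ℝ), ContDiffOn ℝ ∞ F (Prod.fst '' M) ∧
      ∀ p ∈ M, V p = generator ε γ c₁ c₂ c₃ c₄ c₅ F p := by
  have hξ := contDiffOn_fst_comp hV.smooth
  have hφ := contDiffOn_snd_comp hV.smooth 0
  have hz := fun (p : Total) (hp : p ∈ M) => hV.fderiv_xi_eq_zero hM hε hp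
  have hz2 := fun (p : Total) (hp : p ∈ M) v => hV.fderiv_fderiv_xi_eq_zero hM hε hp v
  have hf := fun (p : Total) (hp : p ∈ M) => hV.fderiv_fibreVec_one hM hε hp
  have hd := fun (p : Total) (hp : p ∈ M) => hV.fderiv_fderiv_xi_diag hM hε hp
  have ht := fun (p : Total) (hp : p ∈ M) => hV.fderiv_xi_two_baseVec_two hM hε hγ hp
  -- The constants are `c₁ = ξ¹_y` and `c₅ = ∂φ₁/∂u`; `c₂`, `c₃`, `c₄` arise on integrating `ξ`.
  obtain ⟨c₁, hc₁⟩ := exists_eq_const_of_fderiv_fderiv hM hconn (hξ 0) (w := baseVec 1)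
    (fun p hp => by rw [fderiv_fderiv_comm hM (hξ 0) hp]; exact (hd p hp).2.2.1)
    (fun p hp => (hd p hp).2.2.2.1) (fun p hp => (hz2 p hp _).1.2)
    (fun p hp => (hz2 p hp _).2.1.2)
    (fun p hp => fderiv_fderiv_eq_zero_left hM (hξ 0) (fun p hp => (hf p hp).2.1) hp _)
  obtain ⟨c₅, hc₅⟩ := exists_eq_const_of_fderiv_fderiv hM hconn hφ (w := fibreVec 0)
    (fun p hp => (hV.fderiv_fderiv_phi_space hM hε hp).1)
    (fun p hp => (hV.fderiv_fderiv_phi_space hM hε hp).2)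
    (fun p hp => hV.fderiv_fderiv_phi_time hM hε hp)
    (fun p hp => (hV.fderiv_fderiv_phi_fibreVec_zero hM hε hp).2)
    (fun p hp => fderiv_fderiv_eq_zero_left hM hφ (fun p hp => (hf p hp).1) hp _)
  obtain ⟨c₂, hc₂⟩ := exists_eq_add_const hM hconn ((hξ 0).differentiableOn (by simp))
    (L := c₁ • baseForm 1) (by
      intro p hp
      have h0 := hV.fderiv_xi_zero_diag hM hε hp
      rw [ht p hp] at h0
      apply clm_ext_coordVec
      · simpa [baseForm_apply, baseVec] using h0
      · simpa [baseForm_apply, baseVec] using hc₁ p hp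
      · simpa [baseForm_apply, baseVec] using (hz p hp).1
      · simpa [baseForm_apply, fibreVec] using (hz p hp).2.1
      · simpa [baseForm_apply, fibreVec] using (hf p hp).2.1)
  obtain ⟨c₃, hc₃⟩ := exists_eq_add_const hM hconn ((hξ 1).differentiableOn (by simp))
    (L := -c₁ • baseForm 0) (by
      intro p hp
      have h0 := hV.fderiv_xi_rotation hM hε hp
      have h1 := hV.fderiv_xi_one_diag hM hε hp
      rw [hc₁ p hp] at h0
      rw [ht p hp] at h1
      apply clm_ext_coordVec
      · simpa [baseForm_apply, baseVec] using h0
      · simpa [baseForm_apply, baseVec] using h1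
      · simpa [baseForm_apply, baseVec] using (hz p hp).2.2.1
      · simpa [baseForm_apply, fibreVec] using (hz p hp).2.2.2.1
      · simpa [baseForm_apply, fibreVec] using (hf p hp).2.2.1)
  obtain ⟨c₄, hc₄⟩ := exists_eq_add_const hM hconn ((hξ 2).differentiableOn (by simp))
    (L := 0) (by
      intro p hp
      apply clm_ext_coordVec
      exacts [(hz p hp).2.2.2.2.1, (hz p hp).2.2.2.2.2.1, ht p hp, (hz p hp).2.2.2.2.2.2,
        (hf p hp).2.2.2])
  obtain ⟨F, hF, hFφ⟩ := exists_eq_add_comp_fst hM hfib hφ hc₅ (fun p hp => (hf p hp).1)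
  refine ⟨c₁, c₂, c₃, c₄, c₅, F, hF, fun p hp => ?_⟩
  have h1 : (V p).2 1 = c₅ * p.2 1 + viscoOp ε γ F p.1 := by
    rw [hV.phi_one_eq hM hε hγ hp, hc₅ p hp,
      viscoOp_eq_fderiv (isOpen_image_fst hM) hF ε γ ⟨p, hp, rfl⟩]
    simp only [fderiv_fderiv_split hM hF hFφ hp, fderiv_fderiv_fderiv_split hM hF hFφ hp, baseVec]
    ring
  ext i
  · fin_cases i
    · simpa [generator, baseForm_apply] using hc₂ p hp
    · simpa [generator, baseForm_apply] using hc₃ p hp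
    · simpa [generator] using hc₄ p hp
  · fin_cases i
    · simpa [generator] using hFφ p hp
    · simpa [generator] using h1

end Forward

/-! ### Linearity of the operator and its commutation with plane motions and time shifts -/

section BaseLinear

variable {s : Set Base} {F G : Base → ℝ} {ε γ : ℝ}

theorem contDiffOn_linearComb (hF : ContDiffOn ℝ ∞ F s) (hG : ContDiffOn ℝ ∞ G s) (a b : ℝ) :
    ContDiffOn ℝ ∞ (fun q => a * F q + b * G q) s :=
  (contDiffOn_const.mul hF).add (contDiffOn_const.mul hG)

theorem pderiv_linearComb (hs : IsOpen s) (hF : ContDiffOn ℝ ∞ F s) (hG : ContDiffOn ℝ ∞ G s)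
    (a b : ℝ) (k : Fin 3) : Set.EqOn (pderiv k fun q => a * F q + b * G q)
      (fun q => a * pderiv k F q + b * pderiv k G q) s := by
  intro q hq
  have h := ((differentiableAt_of_contDiffOn hs hF hq).hasFDerivAt.const_mul a).add
    ((differentiableAt_of_contDiffOn hs hG hq).hasFDerivAt.const_mul b)
  have h' : HasFDerivAt (fun q => a * F q + b * G q) _ q := h
  rw [pderiv, h'.fderiv]
  rfl

theorem pderiv_pderiv_linearComb (hs : IsOpen s) (hF : ContDiffOn ℝ ∞ F s)
    (hG : ContDiffOn ℝ ∞ G s) (a b : ℝ) (k l : Fin 3) :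
    Set.EqOn (pderiv k (pderiv l fun q => a * F q + b * G q))
      (fun q => a * pderiv k (pderiv l F) q + b * pderiv k (pderiv l G) q) s :=
  (pderiv_congr hs (pderiv_linearComb hs hF hG a b l) k).trans
    (pderiv_linearComb hs (contDiffOn_pderiv hs hF l) (contDiffOn_pderiv hs hG l) a b k)

theorem contDiffOn_laplacian (hs : IsOpen s) (hF : ContDiffOn ℝ ∞ F s) :
    ContDiffOn ℝ ∞ (laplacian F) s :=
  (contDiffOn_pderiv hs (contDiffOn_pderiv hs hF 0) 0).add
    (contDiffOn_pderiv hs (contDiffOn_pderiv hs hF 1) 1)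

theorem contDiffOn_viscoOp (hs : IsOpen s) (hF : ContDiffOn ℝ ∞ F s) :
    ContDiffOn ℝ ∞ (viscoOp ε γ F) s :=
  ((contDiffOn_pderiv hs (contDiffOn_pderiv hs hF 2) 2).sub
    (contDiffOn_const.mul (contDiffOn_pderiv hs (contDiffOn_laplacian hs hF) 2))).sub
    (contDiffOn_const.mul (contDiffOn_laplacian hs hF))

theorem laplacian_linearComb (hs : IsOpen s) (hF : ContDiffOn ℝ ∞ F s)
    (hG : ContDiffOn ℝ ∞ G s) (a b : ℝ) :
    Set.EqOn (laplacian fun q => a * F q + b * G q)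
      (fun q => a * laplacian F q + b * laplacian G q) s := by
  intro q hq
  simp only [laplacian, pderiv_pderiv_linearComb hs hF hG a b _ _ hq]
  ring

theorem viscoOp_linearComb (hs : IsOpen s) (hF : ContDiffOn ℝ ∞ F s)
    (hG : ContDiffOn ℝ ∞ G s) (a b : ℝ) :
    Set.EqOn (viscoOp ε γ fun q => a * F q + b * G q)
      (fun q => a * viscoOp ε γ F q + b * viscoOp ε γ G q) s := by
  intro q hq
  have hL := laplacian_linearComb hs hF hG a b
  simp only [viscoOp, pderiv_pderiv_linearComb hs hF hG a b _ _ hq, hL hq,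
    ((pderiv_congr hs hL 2).trans (pderiv_linearComb hs (contDiffOn_laplacian hs hF)
      (contDiffOn_laplacian hs hG) a b 2)) hq]
  ring

/-- The derivative along the vector field `(c₁ y + c₂) ∂_x + (-c₁ x + c₃) ∂_y + c₄ ∂_t`. -/
def killingDeriv (c₁ c₂ c₃ c₄ : ℝ) (F : Base → ℝ) (q : Base) : ℝ :=
  (c₁ * q 1 + c₂) * pderiv 0 F q + (-c₁ * q 0 + c₃) * pderiv 1 F q + c₄ * pderiv 2 F q

variable (c₁ c₂ c₃ c₄ : ℝ)

theorem fderiv_eq_killingDeriv (F : Base → ℝ) (q : Base) :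
    fderiv ℝ F q ![c₁ * q 1 + c₂, -c₁ * q 0 + c₃, c₄] = killingDeriv c₁ c₂ c₃ c₄ F q := by
  have h : (![c₁ * q 1 + c₂, -c₁ * q 0 + c₃, c₄] : Base) = (c₁ * q 1 + c₂) • Pi.single 0 1
      + (-c₁ * q 0 + c₃) • Pi.single 1 1 + c₄ • Pi.single 2 1 := by
    ext i
    fin_cases i <;> simp
  rw [h]
  simp only [map_add, map_smul, smul_eq_mul]
  rfl

theorem contDiffOn_killingDeriv (hs : IsOpen s) (hF : ContDiffOn ℝ ∞ F s) :
    ContDiffOn ℝ ∞ (killingDeriv c₁ c₂ c₃ c₄ F) s := by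
  have h0 : ContDiff ℝ ∞ fun q : Base => c₁ * q 1 + c₂ := by fun_prop
  have h1 : ContDiff ℝ ∞ fun q : Base => -c₁ * q 0 + c₃ := by fun_prop
  exact ((h0.contDiffOn.mul (contDiffOn_pderiv hs hF 0)).add
    (h1.contDiffOn.mul (contDiffOn_pderiv hs hF 1))).add
    (contDiffOn_const.mul (contDiffOn_pderiv hs hF 2))

theorem killingDeriv_linearComb (hs : IsOpen s) (hF : ContDiffOn ℝ ∞ F s)
    (hG : ContDiffOn ℝ ∞ G s) (a b : ℝ) :
    Set.EqOn (killingDeriv c₁ c₂ c₃ c₄ fun q => a * F q + b * G q)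
      (fun q => a * killingDeriv c₁ c₂ c₃ c₄ F q + b * killingDeriv c₁ c₂ c₃ c₄ G q) s := by
  intro q hq
  simp only [killingDeriv, pderiv_linearComb hs hF hG a b _ hq]
  ring

/-- Only the rotation coefficients are nonconstant, so they alone contribute to the commutator. The
factors `1 *` give the shape required by `pderiv_linearComb`. -/
theorem pderiv_killingDeriv (hs : IsOpen s) (hF : ContDiffOn ℝ ∞ F s) (k : Fin 3) :
    Set.EqOn (pderiv k (killingDeriv c₁ c₂ c₃ c₄ F))
      (fun q => 1 * killingDeriv c₁ c₂ c₃ c₄ (pderiv k F) q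
        + 1 * (c₁ * (Pi.single k 1 : Base) 1 * pderiv 0 F q
          + -c₁ * (Pi.single k 1 : Base) 0 * pderiv 1 F q)) s := by
  intro q hq
  have hA := fun i : Fin 3 =>
    (differentiableAt_of_contDiffOn hs (contDiffOn_pderiv hs hF i) hq).hasFDerivAt
  have hx := fun i : Fin 3 => hasFDerivAt_apply (𝕜 := ℝ) (F' := fun _ : Fin 3 => ℝ) i q
  have h := ((((hx 1).const_mul c₁).add_const c₂).mul (hA 0)).add
    ((((hx 0).const_mul (-c₁)).add_const c₃).mul (hA 1)) |>.add ((hA 2).const_mul c₄)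
  have h' : HasFDerivAt (killingDeriv c₁ c₂ c₃ c₄ F) _ q := h
  have hc := fun i : Fin 3 => pderiv_comm hs hF i k hq
  simp only [killingDeriv, hc]
  rw [pderiv, h'.fderiv]
  simp [pderiv]
  ring

/-- The two cross terms are `-2 c₁ ∂_x ∂_y F` and `2 c₁ ∂_y ∂_x F`, which cancel. -/
theorem laplacian_killingDeriv (hs : IsOpen s) (hF : ContDiffOn ℝ ∞ F s) :
    Set.EqOn (laplacian (killingDeriv c₁ c₂ c₃ c₄ F))
      (killingDeriv c₁ c₂ c₃ c₄ (laplacian F)) s := by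
  have hP := fun k => contDiffOn_pderiv hs hF k
  have h2 : ∀ k : Fin 3, Set.EqOn (pderiv k (pderiv k (killingDeriv c₁ c₂ c₃ c₄ F)))
      (fun q => killingDeriv c₁ c₂ c₃ c₄ (pderiv k (pderiv k F)) q
        + 2 * (c₁ * (Pi.single k 1 : Base) 1 * pderiv k (pderiv 0 F) q
          + -c₁ * (Pi.single k 1 : Base) 0 * pderiv k (pderiv 1 F) q)) s := by
    intro k q hq
    rw [pderiv_congr hs (pderiv_killingDeriv c₁ c₂ c₃ c₄ hs hF k) k hq,
      pderiv_linearComb hs (contDiffOn_killingDeriv c₁ c₂ c₃ c₄ hs (hP k))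
        (contDiffOn_linearComb (hP 0) (hP 1) _ _) _ _ _ hq]
    simp only [pderiv_linearComb hs (hP 0) (hP 1) _ _ _ hq,
      pderiv_killingDeriv c₁ c₂ c₃ c₄ hs (hP k) k hq, pderiv_comm hs hF _ k hq]
    ring
  intro q hq
  have hadd := killingDeriv_linearComb c₁ c₂ c₃ c₄ hs (contDiffOn_pderiv hs (hP 0) 0)
    (contDiffOn_pderiv hs (hP 1) 1) 1 1 hq
  simp only [one_mul] at hadd
  have e : laplacian F = fun q => pderiv 0 (pderiv 0 F) q + pderiv 1 (pderiv 1 F) q := rfl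
  rw [e, hadd, laplacian, h2 0 hq, h2 1 hq]
  simp only [pderiv_comm hs hF 1 0 hq]
  simp
  ring

theorem viscoOp_killingDeriv (hs : IsOpen s) (hF : ContDiffOn ℝ ∞ F s) :
    Set.EqOn (viscoOp ε γ (killingDeriv c₁ c₂ c₃ c₄ F))
      (killingDeriv c₁ c₂ c₃ c₄ (viscoOp ε γ F)) s := by
  have h2 : ∀ {G : Base → ℝ}, ContDiffOn ℝ ∞ G s →
      Set.EqOn (pderiv 2 (killingDeriv c₁ c₂ c₃ c₄ G))
        (killingDeriv c₁ c₂ c₃ c₄ (pderiv 2 G)) s := fun hG q hq => by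
    simpa using pderiv_killingDeriv c₁ c₂ c₃ c₄ hs hG 2 hq
  have hL := laplacian_killingDeriv c₁ c₂ c₃ c₄ hs hF
  have hLF := contDiffOn_laplacian hs hF
  have htt := contDiffOn_pderiv hs (contDiffOn_pderiv hs hF 2) 2
  intro q hq
  have e : viscoOp ε γ F = fun q => 1 * (1 * pderiv 2 (pderiv 2 F) q
      + -ε * pderiv 2 (laplacian F) q) + -γ * laplacian F q := by
    funext q
    simp only [viscoOp]
    ring
  rw [e, killingDeriv_linearComb c₁ c₂ c₃ c₄ hs
    (contDiffOn_linearComb htt (contDiffOn_pderiv hs hLF 2) _ _) hLF _ _ hq]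
  simp only [killingDeriv_linearComb c₁ c₂ c₃ c₄ hs htt (contDiffOn_pderiv hs hLF 2) _ _ hq]
  rw [viscoOp, pderiv_congr hs (h2 hF) 2 hq, h2 (contDiffOn_pderiv hs hF 2) hq,
    pderiv_congr hs hL 2 hq, h2 hLF hq, hL hq]
  ring

end BaseLinear

/-! ### Every generator is a symmetry -/

section Generator

variable {ε γ c₁ c₂ c₃ c₄ c₅ : ℝ} {F : Base → ℝ} {M : Set Total} {V : Total → Total}

theorem contDiffOn_generator (hM : IsOpen M) (hF : ContDiffOn ℝ ∞ F (Prod.fst '' M))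
    (hV : ∀ p ∈ M, V p = generator ε γ c₁ c₂ c₃ c₄ c₅ F p) : ContDiffOn ℝ ∞ V M := by
  have h0 : ContDiffOn ℝ ∞ (fun p : Total => c₅ * p.2 0 + F p.1) M :=
    contDiffOn_add_comp_fst hF fun _ _ => rfl
  have h1 : ContDiffOn ℝ ∞ (fun p : Total => c₅ * p.2 1 + viscoOp ε γ F p.1) M :=
    contDiffOn_add_comp_fst (contDiffOn_viscoOp (isOpen_image_fst hM) hF) fun _ _ => rfl
  refine ContDiffOn.congr ?_ hV
  refine ContDiffOn.prodMk (contDiffOn_pi.2 fun i => ?_) (contDiffOn_pi.2 fun i => ?_)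
  · have h : ContDiff ℝ ∞ fun p : Total =>
        (![c₁ * p.1 1 + c₂, -c₁ * p.1 0 + c₃, c₄] : Base) i := by
      fin_cases i <;> simp <;> fun_prop
    exact h.contDiffOn
  · fin_cases i
    · exact h0
    · exact h1

theorem fderiv_of_affine {h : Total → ℝ} {L : Total →L[ℝ] ℝ} {d : ℝ} (hM : IsOpen M)
    (hh : ∀ p ∈ M, h p = L p + d) {p : Total} (hp : p ∈ M) : fderiv ℝ h p = L := by
  rw [fderiv_congr_of_eqOn hM hh hp, fderiv_add_const, L.fderiv]

theorem fderiv_of_eq_const {E : Type*} [NormedAddCommGroup E] [NormedSpace ℝ E]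
    {h : Total → E} {e : E} (hM : IsOpen M) (hh : ∀ p ∈ M, h p = e) {p : Total} (hp : p ∈ M) :
    fderiv ℝ h p = 0 := by
  rw [fderiv_congr_of_eqOn hM hh hp, fderiv_fun_const]
  rfl

theorem fderiv_generator_fst (hM : IsOpen M)
    (hV : ∀ p ∈ M, V p = generator ε γ c₁ c₂ c₃ c₄ c₅ F p) {p : Total} (hp : p ∈ M)
    (i : Fin 3) : fderiv ℝ (xi V i) p
      = (![c₁ • baseForm 1, -c₁ • baseForm 0, 0] : Fin 3 → Total →L[ℝ] ℝ) i := by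
  refine fderiv_of_affine (d := ![c₂, c₃, c₄] i) hM (fun p hp => ?_) hp
  rw [xi, hV p hp]
  fin_cases i <;> simp [generator, baseForm_apply]

/-- The `ξ` are affine, so their higher derivatives drop out, and the choice of `φ₂` cancels all
terms in `F`. What is left is `c₅` times the equation. -/
theorem isInfinitesimalSymmetry_of_generator (hM : IsOpen M)
    (hF : ContDiffOn ℝ ∞ F (Prod.fst '' M))
    (hV : ∀ p ∈ M, V p = generator ε γ c₁ c₂ c₃ c₄ c₅ F p) :
    IsInfinitesimalSymmetry ε γ M V := by
  have hsm := contDiffOn_generator hM hF hV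
  refine ⟨hsm, fun z hz heq => ?_⟩
  have h1 := fun i => fderiv_generator_fst hM hV hz i
  have h2 := fun (i : Fin 3) (p : Total) (hp : p ∈ M) =>
    fderiv_of_eq_const hM (fun p hp => fderiv_generator_fst hM hV hp i) hp
  have h3 := fun i : Fin 3 => fderiv_of_eq_const hM (h2 i) hz
  have h2 := fun i : Fin 3 => h2 i _ hz
  have hφ : ∀ p ∈ M, (V p).2 0 = c₅ * p.2 0 + F p.1 := fun p hp => by rw [hV p hp]; rfl
  have hφ1 : (V (proj z)).2 1 = c₅ * z.2 1 0 + viscoOp ε γ F (proj z).1 := by rw [hV _ hz]; rfl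
  rw [prolongApply_equation, equation_prolong hM hsm ε γ hz, hφ1,
    viscoOp_eq_fderiv (isOpen_image_fst hM) hF ε γ ⟨_, hz, rfl⟩]
  simp only [charD2, charD3, jetD, jetD2, jetD3, h1, h2, h3, fderiv_split hM hF hφ hz,
    fderiv_fderiv_split hM hF hφ hz, fderiv_fderiv_fderiv_split hM hF hφ hz,
    Fin.sum_univ_three, totalVec, vertVec]
  simp [baseForm_apply, unitIndex_zero, unitIndex_one, unitIndex_two, equation, proj] at heq ⊢
  linear_combination c₅ * heq

theorem fderiv_generator (hM : IsOpen M) (hF : ContDiffOn ℝ ∞ F (Prod.fst '' M))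
    (hV : ∀ p ∈ M, V p = generator ε γ c₁ c₂ c₃ c₄ c₅ F p) {p : Total} (hp : p ∈ M)
    (v : Total) : fderiv ℝ V p v = (![c₁ * v.1 1, -c₁ * v.1 0, 0],
      ![c₅ * v.2 0 + fderiv ℝ F p.1 v.1, c₅ * v.2 1 + fderiv ℝ (viscoOp ε γ F) p.1 v.1]) := by
  have hsm := contDiffOn_generator hM hF hV
  have hd := (differentiableAt_of_contDiffOn hM hsm hp).hasFDerivAt
  have e1 : ∀ i, (fderiv ℝ V p v).1 i = fderiv ℝ (xi V i) p v := fun i => by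
    rw [(hasFDerivAt_pi'.1 hd.fst i).fderiv]
    rfl
  have e2 : ∀ i, (fderiv ℝ V p v).2 i = fderiv ℝ (phi V i) p v := fun i => by
    rw [(hasFDerivAt_pi'.1 hd.snd i).fderiv]
    rfl
  ext i
  · rw [e1, fderiv_generator_fst hM hV hp]
    fin_cases i <;> simp [baseForm_apply]
  · rw [e2]
    fin_cases i
    · exact fderiv_split hM hF (fun p hp => by rw [phi, hV p hp]; rfl) hp v
    · exact fderiv_split hM (contDiffOn_viscoOp (isOpen_image_fst hM) hF)
        (fun p hp => by rw [phi, hV p hp]; rfl) hp v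

end Generator

/-! ### Linear combinations and brackets of generators -/

section LieAlgebra

variable {ε γ c₁ c₂ c₃ c₄ c₅ d₁ d₂ d₃ d₄ d₅ : ℝ} {F G : Base → ℝ} {M : Set Total}
  {V W : Total → Total}

theorem linearComb_generator (hM : IsOpen M)
    (hF : ContDiffOn ℝ ∞ F (Prod.fst '' M)) (hG : ContDiffOn ℝ ∞ G (Prod.fst '' M))
    (hV : ∀ p ∈ M, V p = generator ε γ c₁ c₂ c₃ c₄ c₅ F p)
    (hW : ∀ p ∈ M, W p = generator ε γ d₁ d₂ d₃ d₄ d₅ G p) (a b : ℝ) {p : Total}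
    (hp : p ∈ M) : (a • V + b • W) p = generator ε γ (a * c₁ + b * d₁) (a * c₂ + b * d₂)
      (a * c₃ + b * d₃) (a * c₄ + b * d₄) (a * c₅ + b * d₅) (fun q => a * F q + b * G q) p := by
  have h := viscoOp_linearComb (ε := ε) (γ := γ) (isOpen_image_fst hM) hF hG a b ⟨p, hp, rfl⟩
  simp only [Pi.add_apply, Pi.smul_apply, hV p hp, hW p hp, generator, h]
  ext i <;> fin_cases i <;> simp <;> ring

/-- The rotation and `u`-scaling parts commute among themselves, hence the zeros. The `∂_f`
component has the required form because `viscoOp` is linear and commutes with `killingDeriv`. -/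
theorem lieBracket_generator (hM : IsOpen M)
    (hF : ContDiffOn ℝ ∞ F (Prod.fst '' M)) (hG : ContDiffOn ℝ ∞ G (Prod.fst '' M))
    (hV : ∀ p ∈ M, V p = generator ε γ c₁ c₂ c₃ c₄ c₅ F p)
    (hW : ∀ p ∈ M, W p = generator ε γ d₁ d₂ d₃ d₄ d₅ G p) {p : Total} (hp : p ∈ M) :
    VectorField.lieBracket ℝ V W p = generator ε γ 0 (d₁ * c₃ - c₁ * d₃) (c₁ * d₂ - d₁ * c₂) 0 0
      (fun q => 1 * (d₅ * F q + -c₅ * G q)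
        + 1 * (1 * killingDeriv c₁ c₂ c₃ c₄ G q + -1 * killingDeriv d₁ d₂ d₃ d₄ F q)) p := by
  have hΩ := isOpen_image_fst hM
  have hpΩ : p.1 ∈ Prod.fst '' M := ⟨p, hp, rfl⟩
  have hKG := contDiffOn_killingDeriv c₁ c₂ c₃ c₄ hΩ hG
  have hKF := contDiffOn_killingDeriv d₁ d₂ d₃ d₄ hΩ hF
  rw [VectorField.lieBracket, fderiv_generator hM hG hW hp, fderiv_generator hM hF hV hp]
  simp only [hV p hp, hW p hp, generator, fderiv_eq_killingDeriv,
    viscoOp_linearComb hΩ (contDiffOn_linearComb hF hG _ _) (contDiffOn_linearComb hKG hKF _ _)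
      _ _ hpΩ, viscoOp_linearComb hΩ hF hG _ _ hpΩ, viscoOp_linearComb hΩ hKG hKF _ _ hpΩ,
    viscoOp_killingDeriv _ _ _ _ hΩ hF hpΩ, viscoOp_killingDeriv _ _ _ _ hΩ hG hpΩ]
  ext i <;> fin_cases i <;> simp <;> ring

end LieAlgebra

end Viscoelastic

end

/-! ### The classification and the Lie algebra property -/

open Viscoelastic in
theorem mainTheorem1 (ε γ : ℝ) (hε : ε ≠ 0) (hγ : γ ≠ 0)
    (M : Set Total) (hopen : IsOpen M) (hconn : IsPreconnected M)
    (hfib : ∀ q : Base, IsPreconnected {w : Fibre | (q, w) ∈ M}) :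
    (∀ V : Total → Total,
      IsInfinitesimalSymmetry ε γ M V ↔
        ∃ (c₁ c₂ c₃ c₄ c₅ : ℝ) (F : Base → ℝ),
          ContDiffOn ℝ ∞ F (Prod.fst '' M) ∧
          ∀ p ∈ M, V p = generator ε γ c₁ c₂ c₃ c₄ c₅ F p) ∧
    (∀ V W : Total → Total,
      IsInfinitesimalSymmetry ε γ M V → IsInfinitesimalSymmetry ε γ M W →
        (∀ a b : ℝ, IsInfinitesimalSymmetry ε γ M (a • V + b • W)) ∧
        IsInfinitesimalSymmetry ε γ M (VectorField.lieBracket ℝ V W)) := by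
  refine ⟨fun V => ⟨fun hV => hV.exists_generator hε hγ hopen hconn hfib, ?_⟩, ?_⟩
  · rintro ⟨c₁, c₂, c₃, c₄, c₅, F, hF, hV⟩
    exact isInfinitesimalSymmetry_of_generator hopen hF hV
  · intro V W hV hW
    obtain ⟨c₁, c₂, c₃, c₄, c₅, F, hF, hV⟩ := hV.exists_generator hε hγ hopen hconn hfib
    obtain ⟨d₁, d₂, d₃, d₄, d₅, G, hG, hW⟩ := hW.exists_generator hε hγ hopen hconn hfib
    have hΩ := isOpen_image_fst hopen
    refine ⟨fun a b => ?_, ?_⟩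
    · exact isInfinitesimalSymmetry_of_generator hopen (contDiffOn_linearComb hF hG a b)
        fun p hp => linearComb_generator hopen hF hG hV hW a b hp
    · exact isInfinitesimalSymmetry_of_generator hopen
        (contDiffOn_linearComb (contDiffOn_linearComb hF hG _ _)
          (contDiffOn_linearComb (contDiffOn_killingDeriv _ _ _ _ hΩ hG)
            (contDiffOn_killingDeriv _ _ _ _ hΩ hF) _ _) _ _)
        fun p hp => lieBracket_generator hopen hF hG hV hW hp
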